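/- Let $m\ge 2$ and $h,n\ge 0$ be integers, and let $\gamma_n$ be the standard Gaussian measure on $\mathbb{R}^n$. For an $N\times N$ complex matrix $A$ with singular values $s_1,\dots,s_N$ put $|||A|||_p=\bigl(\frac1N\sum_i s_i^p\bigr)^{1/p}$, and equip $N\times N$ matrices with $\langle A,B\rangle=\frac1N\operatorname{Tr}A^\dagger B$. Let $\mathcal{B}_0=\mathbb{1},\mathcal{B}_1,\dots,\mathcal{B}_{m^2-1}$ be an orthonormal basis of the space $\mathcal{M}_m$ of $m\times m$ complex matrices consisting of Hermitian matrices; for $\sigma\in\{0,\dots,m^2-1\}^h$ let $\mathcal{B}_\sigma=\mathcal{B}_{\sigma_1}\otimes\cdots\otimes\mathcal{B}_{\sigma_h}$ and $|\sigma|=|\{i:\sigma_i\ne 0\}|$. A random operator $\mathbf{P}\in L^p(\mathcal{M}_m^{\otimes h},\gamma_n)$ is $\mathbf{P}=\sum_\sigma p_\sigma(\mathbf{g})\mathcal{B}_\sigma$ with $\mathbf{g}\sim\gamma_n$ and all $p_\sigma\in L^p(\mathbb{C},\gamma_n)$; write $N_p(\mathbf{P})=\bigl(\mathbb{E}\,|||\mathbf{P}|||_p^p\bigr)^{1/p}$.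 For $0\le\rho\le1$ let $U_\rho f(z)=\mathbb{E}_{\mathbf{x}\sim\gamma_n}f(\rho z+\sqrt{1-\rho^2}\,\mathbf{x})$; let $\Delta_\rho(A)=\rho A+\frac{1-\rho}{m}(\operatorname{Tr}A)\mathbb{1}$ on $\mathcal{M}_m$, let $\Delta_\rho$ on $\mathcal{M}_m^{\otimes h}$ be the composition of the maps $\Delta_\rho$ applied to each of the $h$ tensor factors, and let $$\Gamma_\rho(\mathbf{P})=\sum_\sigma (U_\rho p_\sigma)(\mathbf{g})\,\Delta_\rho(\mathcal{B}_\sigma).$$ Let $\mathbf{P}\in L^2(\mathcal{M}_m^{\otimes h},\gamma_n)$. 1. For every $0\le\rho\le\frac1{\sqrt{3\sqrt m}}$, $\Gamma_\rho(\mathbf{P})\in L^4(\mathcal{M}_m^{\otimes h},\gamma_n)$ and $N_4(\Gamma_\rho(\mathbf{P}))\le N_2(\mathbf{P})$. 2. For $\tau\in\mathbb{Z}_{\ge0}^n$ let $H_\tau(x)=\prod_i H_{\tau_i}(x_i)$ with $H_r(x)=\frac{(-1)^r}{\sqrt{r!}}e^{x^2/2}\frac{d^r}{dx^r}e^{-x^2/2}$,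 and let $\widehat{f}(\tau)=\mathbb{E}[H_\tau(\mathbf{g})f(\mathbf{g})]$. If $\mathbf{P}$ is multilinear, i.e. $\widehat{p_\sigma}(\tau)=0$ for all $\sigma$ and all $\tau\notin\{0,1\}^n$, then $\mathbf{P}\in L^4(\mathcal{M}_m^{\otimes h},\gamma_n)$ and $$N_4(\mathbf{P})\le 3^{d/2}m^{d/4}N_2(\mathbf{P}),\qquad d=\max_{\sigma:\,p_\sigma\ne0}\bigl(\deg p_\sigma+|\sigma|\bigr),\quad \deg f=\max\Bigl\{\sum_i\tau_i:\widehat f(\tau)\ne0\Bigr\},$$ with $d=0$ if $\mathbf{P}=0$ almost surely. -/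

import Mathlib

open MeasureTheory ProbabilityTheory

noncomputable section

namespace RandomOperator

/-! ### Gaussian space -/

/-- The standard `n`-dimensional normal distribution `γ_n`. -/
def gamma (n : ℕ) : Measure (Fin n → ℝ) :=
  Measure.pi fun _ => gaussianReal 0 1

/-- The normalized Hermite polynomial `H_τ(x) = ∏ i, H_{τ i}(x i)`, where
`H_r = He_r / √(r!)` and `He_r` is the probabilists' Hermite polynomial. -/
def hermiteFun {n : ℕ} (τ : Fin n → ℕ) (x : Fin n → ℝ) : ℝ :=
  ∏ i, Polynomial.aeval (x i) (Polynomial.hermite (τ i)) / √((τ i).factorial : ℝ)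

/-- The Hermite coefficient `⟨H_τ, f⟩_{γ_n}` (the `H_τ` are real). -/
def hermiteCoeff {n : ℕ} (f : (Fin n → ℝ) → ℂ) (τ : Fin n → ℕ) : ℂ :=
  ∫ x, (hermiteFun τ x : ℂ) * f x ∂(gamma n)

/-- `f` is multilinear: its Hermite coefficients vanish off `{0,1}^n`. -/
def IsMultilinearFun {n : ℕ} (f : (Fin n → ℝ) → ℂ) : Prop :=
  ∀ τ : Fin n → ℕ, (∃ i, 1 < τ i) → hermiteCoeff f τ = 0

/-- The degree `max {∑ i, τ i : hermiteCoeff f τ ≠ 0}`; it is only used for multilinear functions,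
for which this set is bounded by `n`. -/
def hermiteDegree {n : ℕ} (f : (Fin n → ℝ) → ℂ) : ℕ :=
  sSup {k | ∃ τ : Fin n → ℕ, hermiteCoeff f τ ≠ 0 ∧ k = ∑ i, τ i}

/-- The Ornstein–Uhlenbeck operator `U_ρ f(z) = E f(ρ z + √(1 - ρ²) x)`, `x ∼ γ_n`. -/
def ornsteinUhlenbeck {n : ℕ} (ρ : ℝ) (f : (Fin n → ℝ) → ℂ) (z : Fin n → ℝ) : ℂ :=
  ∫ x, f (ρ • z + √(1 - ρ ^ 2) • x) ∂(gamma n)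

/-! ### Matrix spaces -/

/-- The space `M_m^{⊗h}`: rows and columns are indexed by the tuples `Fin h → Fin m`. -/
abbrev TensorMat (m h : ℕ) : Type :=
  Matrix (Fin h → Fin m) (Fin h → Fin m) ℂ

/-- The normalized `p`-norm `((1/N) ∑ s_i(A)^p)^{1/p}` of an `N × N` matrix, where the `s_i(A)` are
its singular values. -/
def normalizedNorm {ι : Type*} [Fintype ι] [DecidableEq ι] (p : ℝ) (A : Matrix ι ι ℂ) : ℝ :=
  ((1 / (Fintype.card ι : ℝ)) *
    ∑ k ∈ Finset.range (Fintype.card ι),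
      (Matrix.toEuclideanLin A).singularValues k ^ p) ^ (1 / p)

/-- The normalized inner product `⟨A, B⟩ = (1/N) Tr(A† B)` of `N × N` matrices. -/
def matInner {ι : Type*} [Fintype ι] (A B : Matrix ι ι ℂ) : ℂ :=
  (1 / (Fintype.card ι : ℂ)) * (A.conjTranspose * B).trace

/-- A standard orthonormal basis `B_0, …, B_{m²-1}` of `M_m`: orthonormal, all elements Hermitian,
`B_0 = 1`. (An orthonormal family of `m²` elements of `M_m` is a basis.) -/
structure IsStandardBasis {m : ℕ} (B : Fin (m ^ 2) → Matrix (Fin m) (Fin m) ℂ) : Prop where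
  isHermitian : ∀ i, (B i).IsHermitian
  eq_one : ∀ i, i.val = 0 → B i = 1
  orthonormal : ∀ i j, matInner (B i) (B j) = if i = j then 1 else 0

/-- `B_σ = B_{σ 1} ⊗ ⋯ ⊗ B_{σ h}`. -/
def tensorBasis {m h : ℕ} (B : Fin (m ^ 2) → Matrix (Fin m) (Fin m) ℂ)
    (σ : Fin h → Fin (m ^ 2)) : TensorMat m h :=
  Matrix.of fun a b => ∏ k, B (σ k) (a k) (b k)

/-- `|σ|`, the number of nonzero entries of `σ`. -/
def suppCard {m h : ℕ} (σ : Fin h → Fin (m ^ 2)) : ℕ :=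
  (Finset.univ.filter fun k => (σ k).val ≠ 0).card

/-- The depolarizing noise `Δ_ρ(P) = ρ P + ((1 - ρ)/m) (Tr P) 1` on `M_m`. -/
def depolarize {m : ℕ} (ρ : ℝ) (P : Matrix (Fin m) (Fin m) ℂ) : Matrix (Fin m) (Fin m) ℂ :=
  (ρ : ℂ) • P + (((1 - ρ) / m : ℝ) * P.trace) • (1 : Matrix (Fin m) (Fin m) ℂ)

/-- `Δ_ρ` applied to the `k`-th register, the other registers being untouched: for fixed row and
column indices of the other registers, `Δ_ρ` acts on the `m × m` matrix of the remaining ones. -/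
def depolarizeAt {m h : ℕ} (ρ : ℝ) (k : Fin h) (P : TensorMat m h) : TensorMat m h :=
  Matrix.of fun a b =>
    depolarize ρ (Matrix.of fun s t => P (Function.update a k s) (Function.update b k t))
      (a k) (b k)

/-- The noise operator `Δ_ρ = Δ_ρ^{(1)} ⋯ Δ_ρ^{(h)}` on `M_m^{⊗h}`. -/
def depolarizeAll {m h : ℕ} (ρ : ℝ) (P : TensorMat m h) : TensorMat m h :=
  (List.finRange h).foldr (fun k Q => depolarizeAt ρ k Q) P

/-! ### Random operators

A random operator is a function of the Gaussian vector `g ∼ γ_n` with values in `M_m^{⊗h}`. -/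

/-- The coefficient function `p_σ` in `P = ∑ σ, p_σ(g) B_σ`. -/
def coeffFun {m h n : ℕ} (B : Fin (m ^ 2) → Matrix (Fin m) (Fin m) ℂ)
    (P : (Fin n → ℝ) → TensorMat m h) (σ : Fin h → Fin (m ^ 2)) (x : Fin n → ℝ) : ℂ :=
  matInner (tensorBasis B σ) (P x)

/-- `P ∈ L^p(M_m^{⊗h}, γ_n)`: all coefficient functions are in `L^p(ℂ, γ_n)`. -/
def MemLpOp {m h n : ℕ} (B : Fin (m ^ 2) → Matrix (Fin m) (Fin m) ℂ) (p : ENNReal)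
    (P : (Fin n → ℝ) → TensorMat m h) : Prop :=
  ∀ σ, MemLp (coeffFun B P σ) p (gamma n)

/-- The normalized `p`-norm `N_p(P) = (E ‖P‖_p^p)^{1/p}` of a random operator. -/
def opNorm {m h n : ℕ} (p : ℝ) (P : (Fin n → ℝ) → TensorMat m h) : ℝ :=
  (∫ x, normalizedNorm p (P x) ^ p ∂(gamma n)) ^ (1 / p)

/-- The hybrid noise operator `Γ_ρ(P) = ∑ σ, (U_ρ p_σ)(g) Δ_ρ(B_σ)`. -/
def hybridNoise {m h n : ℕ} (B : Fin (m ^ 2) → Matrix (Fin m) (Fin m) ℂ) (ρ : ℝ)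
    (P : (Fin n → ℝ) → TensorMat m h) (x : Fin n → ℝ) : TensorMat m h :=
  ∑ σ : Fin h → Fin (m ^ 2),
    ornsteinUhlenbeck ρ (coeffFun B P σ) x • depolarizeAll ρ (tensorBasis B σ)

/-- `P` is multilinear: all coefficient functions are. -/
def IsMultilinearOp {m h n : ℕ} (B : Fin (m ^ 2) → Matrix (Fin m) (Fin m) ℂ)
    (P : (Fin n → ℝ) → TensorMat m h) : Prop :=
  ∀ σ, IsMultilinearFun (coeffFun B P σ)

open Classical in
/-- The total degree `max_σ (deg p_σ + |σ|)`, where `σ` with `p_σ = 0` do not count (the degree of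
the zero function being `-∞`); it is `0` for `P = 0`. -/
def totalDegree {m h n : ℕ} (B : Fin (m ^ 2) → Matrix (Fin m) (Fin m) ℂ)
    (P : (Fin n → ℝ) → TensorMat m h) : ℕ :=
  (Finset.univ.filter fun σ : Fin h → Fin (m ^ 2) =>
      ∃ τ : Fin n → ℕ, hermiteCoeff (coeffFun B P σ) τ ≠ 0).sup
    fun σ => hermiteDegree (coeffFun B P σ) + suppCard σ

end RandomOperator

end

noncomputable section

namespace RandomOperator

section GaussianPolynomials

open Polynomial
open Finset.HasAntidiagonal (antidiagonal)

/-! ### Polynomials on the one-dimensional Gaussian space -/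

/-! The matrix noise acts pointwise in the Gaussian vector, so the two noises can be treated
separately. For fixed `x`, hypercontractivity of the depolarizing noise bounds the normalized 4-norm
of `hybridNoise B ρ P x` by the normalized 2-norm of `∑ σ, (U_ρ p_σ)(x) B_σ`, which by Parseval is
`(∑ σ, |U_ρ p_σ(x)|²)^{1/2}`. Minkowski's inequality in `L²` (`integral_sum_sq_sq_le`) then reduces
the fourth moment to that of each `U_ρ p_σ`, where `ornsteinUhlenbeck_hypercontractive` applies.

Gaussian side. Integration by parts gives `E[pq] = ∑ l, E[p^(l)] E[q^(l)] / l!` for polynomials.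
Applied to `f² · f²`, followed by Leibniz, Cauchy–Schwarz and the same identity for each derivative
of `f`, it yields `E[f⁴] ≤ (∑ j, 3^j c_j²)²` in the normalized Hermite coefficients `c_j`
(`gaussExp_pow_four_le`). Minkowski carries this to `n` variables one at a time. Since `U_ρ H_τ =
ρ^{|τ|} H_τ`, the factors `3^{|τ|}` are absorbed when `3ρ² ≤ 1`; completeness of the Hermite
polynomials and Fatou's lemma pass from finite expansions to all of `L²`.

Matrix side (`card_mul_fourNormSq_depolarizeAll_sq_le`). By induction on the registers, split `A = 1
⊗ Q + R` along the first one, with `R` of zero partial trace. Noise on that register fixes `1 ⊗ Q`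
and multiplies `R` by `ρ`. In the fourth moment of `1 ⊗ X + ρ Y` the term of first order in `ρ`
vanishes with the partial trace, and what remains is controlled by `4ρ² ≤ 1` and `3ρ⁴m ≤ 1`. The
second condition is the source of `√m`.

For the second claim, a multilinear `P` has a finite expansion and equals `Γ_ρ Q` almost everywhere
for `ρ = 1/√(3√m)`, where `Q` has its coefficients multiplied by `ρ^{-(|τ|+|σ|)}`. This costs at
most `ρ^{-d}` in the 2-norm. -/

/-- The probabilists' Hermite polynomial with real coefficients. -/
def hermiteR (k : ℕ) : ℝ[X] := (hermite k).map (Int.castRingHom ℝ)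

lemma eval_hermiteR (k : ℕ) (x : ℝ) : (hermiteR k).eval x = aeval x (hermite k) := by
  rw [hermiteR, eval_map, aeval_def]; rfl

lemma hermiteR_zero : hermiteR 0 = 1 := by simp [hermiteR]

lemma hermiteR_succ (k : ℕ) : hermiteR (k + 1) = X * hermiteR k - derivative (hermiteR k) := by
  simp [hermiteR, hermite_succ, derivative_map]

lemma natDegree_hermiteR (k : ℕ) : (hermiteR k).natDegree = k := by
  rw [hermiteR, (hermite_monic k).natDegree_map, natDegree_hermite]

lemma derivative_hermiteR_succ (k : ℕ) :
    derivative (hermiteR (k + 1)) = ((k : ℝ) + 1) • hermiteR k := by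
  induction k with
  | zero => simp [hermiteR_succ, hermiteR_zero]
  | succ k ih =>
    rw [hermiteR_succ (k + 1), derivative_sub, derivative_mul, ih, derivative_X, derivative_smul]
    push_cast
    rw [show ((k : ℝ) + 1 + 1) • hermiteR (k + 1) =
      hermiteR (k + 1) + ((k : ℝ) + 1) • hermiteR (k + 1) by module]
    conv_rhs => rw [hermiteR_succ k]
    rw [hermiteR_succ k]
    simp only [smul_eq_C_mul]
    ring

/-- Every polynomial is a linear combination of Hermite polynomials. -/
lemma mem_span_hermiteR (p : ℝ[X]) : p ∈ Submodule.span ℝ (Set.range hermiteR) := by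
  have hX : ∀ q ∈ Submodule.span ℝ (Set.range hermiteR),
      X * q ∈ Submodule.span ℝ (Set.range hermiteR) := by
    intro q hq
    induction hq using Submodule.span_induction with
    | mem q hq =>
      obtain ⟨k, rfl⟩ := hq
      have h : X * hermiteR k = hermiteR (k + 1) + derivative (hermiteR k) := by
        rw [hermiteR_succ]; ring
      rw [h]
      refine Submodule.add_mem _ (Submodule.subset_span ⟨_, rfl⟩) ?_
      cases k with
      | zero => simp [hermiteR_zero]
      | succ k =>
        rw [derivative_hermiteR_succ]
        exact Submodule.smul_mem _ _ (Submodule.subset_span ⟨_, rfl⟩)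
    | zero => simp
    | add a b _ _ ha hb => rw [mul_add]; exact Submodule.add_mem _ ha hb
    | smul c a _ ha => rw [mul_smul_comm]; exact Submodule.smul_mem _ _ ha
  induction p using Polynomial.induction_on' with
  | add p q hp hq => exact Submodule.add_mem _ hp hq
  | monomial k a =>
    rw [← C_mul_X_pow_eq_monomial, ← smul_eq_C_mul]
    refine Submodule.smul_mem _ _ ?_
    induction k with
    | zero => exact Submodule.subset_span ⟨0, by simp [hermiteR_zero]⟩
    | succ k ih => rw [pow_succ']; exact hX _ ih

lemma memLp_eval_gaussianReal (p : ℝ[X]) (r : ENNReal) (hr : r ≠ ⊤) :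
    MemLp (fun x => p.eval x) r (gaussianReal 0 1) := by
  induction p using Polynomial.induction_on' with
  | add p q hp hq => simp only [eval_add]; exact hp.add hq
  | monomial k a =>
    simp only [eval_monomial]
    refine MemLp.const_mul ?_ a
    cases k with
    | zero => simpa using memLp_const (1 : ℝ)
    | succ k =>
      -- The power `x^(k+1)` lies in `L^r` because `x` lies in `L^{r(k+1)}`.
      have h := memLp_id_gaussianReal' (μ := 0) (v := 1) (r * (k + 1 : ℕ))
        (ENNReal.mul_ne_top hr (ENNReal.natCast_ne_top _))
      have h2 := h.norm_rpow_div (q := ((k + 1 : ℕ) : ENNReal))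
      have e : r * ((k + 1 : ℕ) : ENNReal) / ((k + 1 : ℕ) : ENNReal) = r :=
        ENNReal.mul_div_cancel_right (by simp) (ENNReal.natCast_ne_top _)
      rw [e] at h2
      refine h2.of_le (by fun_prop) (Filter.Eventually.of_forall fun x => ?_)
      simp only [ENNReal.toReal_natCast, Real.rpow_natCast, id]
      simp

lemma integrable_eval_gaussianReal (p : ℝ[X]) :
    Integrable (fun x => p.eval x) (gaussianReal 0 1) :=
  memLp_one_iff_integrable.1 (memLp_eval_gaussianReal p 1 (by simp))

/-- The expectation of a polynomial in a standard Gaussian variable. -/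
def gaussExp : ℝ[X] →ₗ[ℝ] ℝ where
  toFun p := ∫ x, p.eval x ∂(gaussianReal 0 1)
  map_add' p q := by
    simp only [eval_add]
    exact integral_add (integrable_eval_gaussianReal p) (integrable_eval_gaussianReal q)
  map_smul' c p := by
    simp only [eval_smul, smul_eq_mul, RingHom.id_apply]
    exact integral_const_mul _ _

lemma gaussExp_apply (p : ℝ[X]) : gaussExp p = ∫ x, p.eval x ∂(gaussianReal 0 1) := rfl

lemma gaussExp_one : gaussExp 1 = 1 := by simp [gaussExp_apply]

lemma hasDerivAt_gaussianPDFReal (x : ℝ) :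
    HasDerivAt (gaussianPDFReal 0 1) (-x * gaussianPDFReal 0 1 x) x := by
  have h : HasDerivAt (fun y : ℝ => (√(2 * Real.pi * 1))⁻¹ * Real.exp (-(y - 0) ^ 2 / (2 * 1)))
      ((√(2 * Real.pi * 1))⁻¹ * (Real.exp (-(x - 0) ^ 2 / (2 * 1)) *
        (-(2 * (x - 0)) / (2 * 1)))) x := by
    refine ((HasDerivAt.exp ?_)).const_mul _
    have := (((hasDerivAt_id x).sub_const 0).pow 2).neg.div_const (2 * 1)
    simpa using this
  convert h using 1
  · ext y; simp [gaussianPDFReal]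
  · simp [gaussianPDFReal]; ring

lemma integrable_eval_mul_gaussianPDFReal (p : ℝ[X]) :
    Integrable (fun x => p.eval x * gaussianPDFReal 0 1 x) := by
  have h := integrable_eval_gaussianReal p
  rw [gaussianReal_of_var_ne_zero 0 one_ne_zero] at h
  rw [integrable_withDensity_iff_integrable_smul'] at h
  · simpa [toReal_gaussianPDF, mul_comm] using h
  · exact measurable_gaussianPDF 0 1
  · exact Filter.Eventually.of_forall fun x => gaussianPDF_lt_top

/-- Gaussian integration by parts. -/
lemma gaussExp_X_mul (p : ℝ[X]) : gaussExp (X * p) = gaussExp (derivative p) := by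
  have h : ∫ x, ((derivative p).eval x - x * p.eval x) * gaussianPDFReal 0 1 x = 0 := by
    refine integral_eq_zero_of_hasDerivAt_of_integrable
      (f := fun x => p.eval x * gaussianPDFReal 0 1 x) (fun x => ?_) ?_
      (integrable_eval_mul_gaussianPDFReal p)
    · have h := (p.hasDerivAt x).mul (hasDerivAt_gaussianPDFReal x)
      rw [show eval x (derivative p) * gaussianPDFReal 0 1 x +
        eval x p * (-x * gaussianPDFReal 0 1 x) =
        ((derivative p).eval x - x * p.eval x) * gaussianPDFReal 0 1 x by ring] at h
      exact h
    · refine (integrable_eval_mul_gaussianPDFReal (derivative p - X * p)).congr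
        (Filter.Eventually.of_forall fun x => ?_)
      simp only [eval_sub, eval_mul, eval_X]
  have h2 : gaussExp (derivative p - X * p) = 0 := by
    rw [gaussExp_apply, integral_gaussianReal_eq_integral_smul one_ne_zero]
    refine Eq.trans ?_ h
    congr 1; ext x; simp [mul_comm]
  rw [map_sub] at h2
  linarith

/-- `X - d/dx`, which raises Hermite polynomials, is the adjoint of `d/dx` under the Gaussian
measure. Hermite coefficients thus become expectations of derivatives, the form used in all the
one-variable estimates. -/
lemma gaussExp_hermiteR_mul (k : ℕ) (p : ℝ[X]) :
    gaussExp (hermiteR k * p) = gaussExp (derivative^[k] p) := by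
  induction k generalizing p with
  | zero => simp [hermiteR_zero]
  | succ k ih =>
    rw [hermiteR_succ, sub_mul, map_sub, mul_assoc, gaussExp_X_mul, derivative_mul, map_add, ih,
      Function.iterate_succ_apply]
    ring

lemma gaussExp_hermiteR_mul_hermiteR (k l : ℕ) :
    gaussExp (hermiteR k * hermiteR l) = if k = l then (k.factorial : ℝ) else 0 := by
  have hlt : ∀ k l : ℕ, l < k → gaussExp (hermiteR k * hermiteR l) = 0 := fun k l h => by
    rw [gaussExp_hermiteR_mul, iterate_derivative_eq_zero (by rwa [natDegree_hermiteR]), map_zero]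
  split_ifs with h
  · subst h
    rw [gaussExp_hermiteR_mul]
    induction k with
    | zero => simp [hermiteR_zero, gaussExp_one]
    | succ k ih =>
      rw [Function.iterate_succ_apply, derivative_hermiteR_succ, iterate_derivative_smul, map_smul,
        ih, Nat.factorial_succ]
      push_cast; rfl
  · rcases lt_or_gt_of_ne h with h | h
    · rw [mul_comm]; exact hlt _ _ h
    · exact hlt _ _ h

/-- Parseval's identity for polynomials on Gaussian space. -/
lemma gaussExp_mul (p q : ℝ[X]) (N : ℕ) (hq : q.natDegree < N) :
    gaussExp (p * q) = ∑ l ∈ Finset.range N,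
      gaussExp (derivative^[l] p) * gaussExp (derivative^[l] q) / (l.factorial : ℝ) := by
  -- Both sides are linear in `p`, so `p` may be taken to be a Hermite polynomial; orthogonality
  -- then leaves a single term on the right. The degree bound is needed on `q` alone, since the
  -- terms with `l ≥ N` die through `q`.
  have hp := mem_span_hermiteR p
  induction hp using Submodule.span_induction with
  | mem p hp =>
    obtain ⟨k, rfl⟩ := hp
    rw [gaussExp_hermiteR_mul]
    simp_rw [← gaussExp_hermiteR_mul _ (hermiteR k), gaussExp_hermiteR_mul_hermiteR]
    by_cases hk : k < N
    · rw [Finset.sum_eq_single k]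
      · simp; field_simp
      · intro b _ hb; simp [hb]
      · simp [hk]
    · rw [iterate_derivative_eq_zero (by omega), map_zero, Finset.sum_eq_zero]
      intro l hl
      rw [if_neg]
      · simp
      · have := Finset.mem_range.1 hl; omega
  | zero => simp
  | add a b _ _ ha hb =>
    rw [add_mul, map_add, ha, hb, ← Finset.sum_add_distrib]
    refine Finset.sum_congr rfl fun l _ => ?_
    rw [iterate_map_add, map_add]; ring
  | smul c a _ ha =>
    rw [smul_mul_assoc, map_smul, ha, smul_eq_mul, Finset.mul_sum]
    refine Finset.sum_congr rfl fun l _ => ?_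
    rw [iterate_derivative_smul, map_smul, smul_eq_mul]; ring

lemma gaussExp_sq_nonneg (p : ℝ[X]) : 0 ≤ gaussExp (p ^ 2) :=
  integral_nonneg fun x => by simp only [eval_pow, Pi.zero_apply]; positivity

lemma gaussExp_mul_sq_le (p q : ℝ[X]) :
    gaussExp (p * q) ^ 2 ≤ gaussExp (p ^ 2) * gaussExp (q ^ 2) := by
  have h : ∀ t : ℝ, 0 ≤ gaussExp (q ^ 2) * (t * t) + (2 * gaussExp (p * q)) * t
      + gaussExp (p ^ 2) := by
    intro t
    have h := gaussExp_sq_nonneg (p + t • q)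
    have e : (p + t • q) ^ 2 = p ^ 2 + (2 * t) • (p * q) + (t * t) • q ^ 2 := by
      simp only [smul_eq_C_mul, map_mul, map_ofNat]; ring
    rw [e, map_add, map_add, map_smul, map_smul, smul_eq_mul, smul_eq_mul] at h
    linarith
  have := discrim_le_zero h
  rw [discrim] at this
  linarith

/-- This is an equality: Parseval for each derivative gives `E[f^(j)]²` the coefficient `∑ 2^u/(u!
l!)` over `u + l = j`, which is `(2+1)^j / j!`. -/
lemma sum_weighted_derivative_le (f : ℝ[X]) (N : ℕ) (hf : f.natDegree < N) :
    ∑ u ∈ Finset.range N, 2 ^ u / (u.factorial : ℝ) * gaussExp ((derivative^[u] f) ^ 2) ≤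
      ∑ j ∈ Finset.range N, 3 ^ j / (j.factorial : ℝ) * gaussExp (derivative^[j] f) ^ 2 := by
  have h1 : ∀ u ∈ Finset.range N,
      2 ^ u / (u.factorial : ℝ) * gaussExp ((derivative^[u] f) ^ 2) =
      ∑ l ∈ Finset.range N, 2 ^ u / ((u.factorial : ℝ) * l.factorial) *
        gaussExp (derivative^[u + l] f) ^ 2 := by
    intro u _
    rw [pow_two (derivative^[u] f), gaussExp_mul _ _ N
      ((natDegree_iterate_derivative f u).trans_lt (by omega)), Finset.mul_sum]
    refine Finset.sum_congr rfl fun l _ => ?_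
    rw [← Function.iterate_add_apply, add_comm l u]
    field_simp
  rw [Finset.sum_congr rfl h1, ← Finset.sum_product']
  have h2 : ∀ j ∈ Finset.range N,
      3 ^ j / (j.factorial : ℝ) * gaussExp (derivative^[j] f) ^ 2 =
      ∑ a ∈ antidiagonal j, 2 ^ a.1 / ((a.1.factorial : ℝ) * a.2.factorial) *
        gaussExp (derivative^[a.1 + a.2] f) ^ 2 := by
    intro j _
    have e : (3 : ℝ) ^ j = ∑ a ∈ antidiagonal j, (j.choose a.1 : ℝ) * 2 ^ a.1 := by
      rw [show (3 : ℝ) = 2 + 1 by norm_num, (Commute.all (2 : ℝ) 1).add_pow']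
      simp
    rw [e, Finset.sum_div, Finset.sum_mul]
    refine Finset.sum_congr rfl fun a ha => ?_
    rw [Finset.HasAntidiagonal.mem_antidiagonal] at ha
    rw [ha, Nat.cast_choose ℝ (by omega : a.1 ≤ j), show j - a.1 = a.2 by omega]
    field_simp
  rw [Finset.sum_congr rfl h2, Finset.sum_sigma']
  refine le_of_eq ?_
  symm
  refine Finset.sum_of_injOn (fun a => (a.2.1, a.2.2)) ?_ ?_ ?_ ?_
  · rintro ⟨j, a, b⟩ ha ⟨k, c, d⟩ hb hab
    simp at ha hb hab
    obtain ⟨rfl, rfl⟩ := hab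
    obtain rfl : j = k := by omega
    rfl
  · rintro ⟨j, a⟩ ha
    simp at ha ⊢
    omega
  · rintro ⟨u, l⟩ _ h2
    simp only [Set.mem_image, Finset.mem_coe, Finset.mem_sigma, Finset.mem_range,
      Finset.HasAntidiagonal.mem_antidiagonal, not_exists, not_and] at h2
    have : N ≤ u + l := by
      by_contra h
      exact h2 ⟨u + l, (u, l)⟩ ⟨by simp only; omega, rfl⟩ rfl
    rw [iterate_derivative_eq_zero (by simp only; omega)]
    simp
  · rintro ⟨j, a⟩ _; rfl

/-- Gaussian hypercontractivity, from `L²` to `L⁴`, for real polynomials in one variable. -/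
lemma gaussExp_pow_four_le (f : ℝ[X]) (N : ℕ) (hf : f.natDegree < N) :
    gaussExp (f ^ 4) ≤
      (∑ j ∈ Finset.range N, 3 ^ j / (j.factorial : ℝ) * gaussExp (derivative^[j] f) ^ 2) ^ 2 := by
  set b : ℕ → ℝ := fun u => gaussExp ((derivative^[u] f) ^ 2)
  have hb : ∀ u, 0 ≤ b u := fun u => gaussExp_sq_nonneg _
  have hb0 : ∀ u, N ≤ u → b u = 0 := fun u hu => by
    simp only [b]; rw [iterate_derivative_eq_zero (by omega)]; simp
  set w : ℕ → ℝ := fun u => 2 ^ u / (u.factorial : ℝ) * b u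
  have hw : ∀ u, 0 ≤ w u := fun u => by have := hb u; positivity
  -- Leibniz expands the derivative of `f²` with binomial weights of total mass `2^l`.
  -- Cauchy–Schwarz for these weights costs `2^l = 2^(a.1) * 2^(a.2)`, which is why `w` carries
  -- `2^u`.
  have key : ∀ l : ℕ, gaussExp (derivative^[l] (f ^ 2)) ^ 2 / (l.factorial : ℝ) ≤
      ∑ a ∈ antidiagonal l, w a.1 * w a.2 := by
    intro l
    have e1 : gaussExp (derivative^[l] (f ^ 2)) = ∑ a ∈ antidiagonal l,
        √(l.choose a.1 : ℝ) *
          (√(l.choose a.1 : ℝ) * gaussExp (derivative^[a.2] f * derivative^[a.1] f)) := by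
      rw [pow_two, iterate_derivative_mul, map_sum,
        Finset.Nat.sum_antidiagonal_eq_sum_range_succ_mk]
      refine Finset.sum_congr rfl fun k _ => ?_
      rw [← mul_assoc, Real.mul_self_sqrt (by positivity), map_nsmul, nsmul_eq_mul]
    have e2 : ∑ a ∈ antidiagonal l, √(l.choose a.1 : ℝ) ^ 2 = 2 ^ l := by
      have : ∀ a ∈ antidiagonal l, √(l.choose a.1 : ℝ) ^ 2 = (l.choose a.1 : ℝ) :=
        fun a _ => Real.sq_sqrt (by positivity)
      rw [Finset.sum_congr rfl this, Finset.Nat.sum_antidiagonal_eq_sum_range_succ_mk]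
      exact_mod_cast Nat.sum_range_choose l
    have e3 := Finset.sum_mul_sq_le_sq_mul_sq (antidiagonal l)
      (fun a => √(l.choose a.1 : ℝ))
      (fun a => √(l.choose a.1 : ℝ) * gaussExp (derivative^[a.2] f * derivative^[a.1] f))
    rw [← e1, e2] at e3
    rw [div_le_iff₀ (by positivity), Finset.sum_mul]
    refine e3.trans ?_
    rw [Finset.mul_sum]
    refine Finset.sum_le_sum fun a ha => ?_
    rw [Finset.HasAntidiagonal.mem_antidiagonal] at ha
    rw [mul_pow, Real.sq_sqrt (by positivity)]
    have e4 := gaussExp_mul_sq_le (derivative^[a.2] f) (derivative^[a.1] f)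
    have e5 : w a.1 * w a.2 * (l.factorial : ℝ) =
        2 ^ l * ((l.choose a.1 : ℝ) * (b a.2 * b a.1)) := by
      rw [Nat.cast_choose ℝ (by omega : a.1 ≤ l), show l - a.1 = a.2 by omega, ← ha]
      simp only [w, pow_add]
      field_simp
    rw [e5]
    gcongr
  have hdeg : (f ^ 2).natDegree < 2 * N := natDegree_pow_le.trans_lt (by omega)
  -- Pairs outside the square `[0, N)²` contribute nothing, because derivatives of order at least
  -- `N` vanish.
  have hW : ∑ l ∈ Finset.range (2 * N), ∑ a ∈ antidiagonal l, w a.1 * w a.2 ≤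
      (∑ u ∈ Finset.range N, w u) ^ 2 := by
    rw [pow_two, Finset.sum_mul_sum, ← Finset.sum_product', Finset.sum_sigma']
    refine le_of_eq (Finset.sum_of_injOn (fun a => ⟨a.1 + a.2, a⟩) ?_ ?_ ?_ ?_).symm
    · rintro a _ b _ hab
      simp only [Sigma.mk.injEq, heq_eq_eq] at hab
      exact hab.2
    · rintro ⟨u, v⟩ ha
      simp at ha ⊢
      omega
    · rintro ⟨l, u, v⟩ hl h2
      simp only [Finset.mem_sigma, Finset.mem_range, Finset.HasAntidiagonal.mem_antidiagonal] at hl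
      simp only [Set.mem_image, Finset.mem_coe, Finset.mem_product, Finset.mem_range,
        not_exists, not_and] at h2
      have : N ≤ u ∨ N ≤ v := by
        by_contra h
        refine h2 (u, v) (by simp only; omega) ?_
        simp [hl.2]
      rcases this with h | h <;> simp [w, hb0 _ h]
    · intro a _; rfl
  calc gaussExp (f ^ 4) = gaussExp (f ^ 2 * f ^ 2) := by ring_nf
    _ = ∑ l ∈ Finset.range (2 * N), gaussExp (derivative^[l] (f ^ 2)) ^ 2 / (l.factorial : ℝ) := by
        rw [gaussExp_mul _ _ _ hdeg]; simp only [pow_two]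
    _ ≤ ∑ l ∈ Finset.range (2 * N), ∑ a ∈ antidiagonal l, w a.1 * w a.2 :=
        Finset.sum_le_sum fun l _ => key l
    _ ≤ (∑ u ∈ Finset.range N, w u) ^ 2 := hW
    _ ≤ _ := by
        refine pow_le_pow_left₀ (Finset.sum_nonneg fun u _ => hw u) ?_ 2
        exact sum_weighted_derivative_le f N hf

/-- The normalized Hermite polynomial in one variable. -/
def hermite1 (k : ℕ) (x : ℝ) : ℝ := aeval x (hermite k) / √(k.factorial : ℝ)

lemma integral_sum_hermite1_pow_four_le (D : ℕ) (c : Fin D → ℝ) :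
    ∫ x, (∑ j, c j * hermite1 j x) ^ 4 ∂(gaussianReal 0 1) ≤
      (∑ j : Fin D, 3 ^ (j : ℕ) * c j ^ 2) ^ 2 := by
  set f : ℝ[X] := ∑ j : Fin D, (c j / √((j : ℕ).factorial : ℝ)) • hermiteR j with hf
  -- The bound is `D + 1` because for `D = 0` the zero polynomial has `natDegree` zero; the extra
  -- term of index `D` vanishes below.
  have hdeg : f.natDegree < D + 1 := by
    refine Nat.lt_succ_of_le (natDegree_sum_le_of_forall_le _ _ fun j _ => ?_)
    exact (natDegree_smul_le _ _).trans (by rw [natDegree_hermiteR]; exact j.2.le)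
  have h := gaussExp_pow_four_le f (D + 1) hdeg
  have e1 : gaussExp (f ^ 4) = ∫ x, (∑ j, c j * hermite1 j x) ^ 4 ∂(gaussianReal 0 1) := by
    rw [gaussExp_apply]
    congr 1; ext x
    simp only [hf, eval_pow, eval_finsetSum, eval_smul, eval_hermiteR, smul_eq_mul, hermite1]
    congr 1
    refine Finset.sum_congr rfl fun j _ => by ring
  have e2 : ∀ k : ℕ, gaussExp (derivative^[k] f) =
      if hk : k < D then c ⟨k, hk⟩ * √(k.factorial : ℝ) else 0 := by
    intro k
    rw [← gaussExp_hermiteR_mul, hf, Finset.mul_sum, map_sum]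
    simp only [mul_smul_comm, map_smul, gaussExp_hermiteR_mul_hermiteR, smul_eq_mul]
    split_ifs with hk
    · rw [Finset.sum_eq_single ⟨k, hk⟩]
      · simp only [if_true]
        rw [div_mul_eq_mul_div, mul_div_assoc, Real.div_sqrt]
      · intro j _ hj
        rw [if_neg (fun h => hj (Fin.ext h.symm)), mul_zero]
      · simp
    · refine Finset.sum_eq_zero fun j _ => ?_
      rw [if_neg (by omega), mul_zero]
  rw [e1] at h
  refine h.trans (le_of_eq ?_)
  rw [Finset.sum_range_succ, e2 D, dif_neg (lt_irrefl D), Finset.sum_range]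
  simp only [e2]
  congr 1
  simp only [Fin.is_lt, dite_true]
  rw [zero_pow two_ne_zero, mul_zero, add_zero]
  refine Finset.sum_congr rfl fun j _ => ?_
  rw [mul_pow, Real.sq_sqrt (by positivity)]
  field_simp

end GaussianPolynomials

section HermiteExpansions

open Polynomial

/-! ### Hypercontractivity for Hermite expansions in several variables -/

instance (n : ℕ) : IsProbabilityMeasure (gamma n) := by
  unfold gamma; infer_instance

lemma integral_mul_le_sqrt_mul_sqrt {Ω : Type*} [MeasurableSpace Ω] {μ : Measure Ω} {f g : Ω → ℝ}
    (hf : MemLp f 2 μ) (hg : MemLp g 2 μ) :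
    ∫ x, f x * g x ∂μ ≤ √(∫ x, f x ^ 2 ∂μ) * √(∫ x, g x ^ 2 ∂μ) := by
  have h1 : ∫ x, f x * g x ∂μ ≤ ∫ x, ‖f x‖ * ‖g x‖ ∂μ := by
    refine integral_mono (hg.integrable_mul hf |>.congr ?_)
      (hg.norm.integrable_mul hf.norm |>.congr ?_)
      fun x => ?_
    · exact Filter.Eventually.of_forall fun x => by simp [mul_comm]
    · exact Filter.Eventually.of_forall fun x => by simp [mul_comm]
    · simp only; rw [← norm_mul]; exact le_abs_self _
  refine h1.trans ?_
  have h2 := integral_mul_norm_le_Lp_mul_Lq (μ := μ) (f := f) (g := g)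
    (p := 2) (q := 2) Real.HolderConjugate.two_two (by simpa using hf) (by simpa using hg)
  refine h2.trans (le_of_eq ?_)
  rw [Real.sqrt_eq_rpow, Real.sqrt_eq_rpow]
  simp

lemma memLp_sq {Ω : Type*} [MeasurableSpace Ω] {μ : Measure Ω} {f : Ω → ℝ}
    (hf : MemLp f 4 μ) : MemLp (fun x => f x ^ 2) 2 μ := by
  have h := hf.norm_rpow_div (q := 2)
  have e : (4 : ENNReal) / 2 = 2 := by
    rw [show (4 : ENNReal) = 2 * 2 by norm_num]
    exact ENNReal.mul_div_cancel_right (by simp) (by simp)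
  rw [e] at h
  refine h.of_le (hf.1.pow 2) (Filter.Eventually.of_forall fun x => ?_)
  simp

/-- Minkowski's inequality in `L²` for weighted sums of squares. -/
lemma integral_sum_sq_sq_le {Ω ι : Type*} [MeasurableSpace Ω] {μ : Measure Ω} (s : Finset ι)
    (w : ι → ℝ) (hw : ∀ j ∈ s, 0 ≤ w j) (f : ι → Ω → ℝ) (hf : ∀ j ∈ s, MemLp (f j) 4 μ) :
    ∫ x, (∑ j ∈ s, w j * f j x ^ 2) ^ 2 ∂μ ≤ (∑ j ∈ s, w j * √(∫ x, f j x ^ 4 ∂μ)) ^ 2 := by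
  have h_int : ∀ j ∈ s, ∀ k ∈ s, Integrable (fun x => f j x ^ 2 * f k x ^ 2) μ :=
    fun j hj k hk => (memLp_sq (hf k hk)).integrable_mul (memLp_sq (hf j hj)) |>.congr
      (Filter.Eventually.of_forall fun x => by simp [mul_comm])
  -- Once the square is expanded, Cauchy–Schwarz on each product `f j² f k²` lets the double sum
  -- factor again.
  have e : ∀ x, (∑ j ∈ s, w j * f j x ^ 2) ^ 2 =
      ∑ j ∈ s, ∑ k ∈ s, w j * w k * (f j x ^ 2 * f k x ^ 2) := fun x => by
    rw [pow_two, Finset.sum_mul_sum]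
    exact Finset.sum_congr rfl fun j _ => Finset.sum_congr rfl fun k _ => by ring
  simp_rw [e]
  rw [integral_finsetSum _ fun j hj => integrable_finsetSum _ fun k hk =>
    (h_int j hj k hk).const_mul _, pow_two, Finset.sum_mul_sum]
  refine Finset.sum_le_sum fun j hj => ?_
  rw [integral_finsetSum _ fun k hk => (h_int j hj k hk).const_mul _]
  refine Finset.sum_le_sum fun k hk => ?_
  rw [integral_const_mul]
  have h := integral_mul_le_sqrt_mul_sqrt (memLp_sq (hf j hj)) (memLp_sq (hf k hk))
  simp only [← pow_mul] at h
  calc w j * w k * ∫ x, f j x ^ 2 * f k x ^ 2 ∂μ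
      ≤ w j * w k * (√(∫ x, f j x ^ 4 ∂μ) * √(∫ x, f k x ^ 4 ∂μ)) :=
        mul_le_mul_of_nonneg_left h (mul_nonneg (hw j hj) (hw k hk))
    _ = _ := by ring

lemma continuous_hermite1 (k : ℕ) : Continuous (hermite1 k) := by
  unfold hermite1
  exact ((hermite k).continuous_aeval).div_const _

lemma memLp_hermite1 (k : ℕ) (r : ENNReal) (hr : r ≠ ⊤) :
    MemLp (hermite1 k) r (gaussianReal 0 1) := by
  have := (memLp_eval_gaussianReal (hermiteR k) r hr).const_mul (√(k.factorial : ℝ))⁻¹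
  refine this.congr_norm (continuous_hermite1 k).aestronglyMeasurable
    (Filter.Eventually.of_forall fun x => ?_)
  simp only [hermite1, eval_hermiteR, div_eq_inv_mul]

lemma hermiteFun_eq_prod {n : ℕ} (τ : Fin n → ℕ) (x : Fin n → ℝ) :
    hermiteFun τ x = ∏ i, hermite1 (τ i) (x i) := rfl

lemma continuous_hermiteFun {n : ℕ} (τ : Fin n → ℕ) : Continuous (hermiteFun τ) := by
  simp only [funext (hermiteFun_eq_prod τ)]
  exact continuous_finsetProd _ fun i _ => (continuous_hermite1 _).comp (continuous_apply i)

lemma memLp_hermiteFun {n : ℕ} (τ : Fin n → ℕ) (r : ENNReal) (hr : r ≠ ⊤) :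
    MemLp (hermiteFun τ) r (gamma n) := by
  by_cases h0 : r = 0
  · subst h0
    exact memLp_zero_iff_aestronglyMeasurable.2 (continuous_hermiteFun τ).aestronglyMeasurable
  rw [← integrable_norm_rpow_iff (continuous_hermiteFun τ).aestronglyMeasurable h0 hr]
  have : (fun x => ‖hermiteFun τ x‖ ^ r.toReal) =
      fun x : Fin n → ℝ => ∏ i, ‖hermite1 (τ i) (x i)‖ ^ r.toReal := by
    ext x
    rw [hermiteFun_eq_prod, norm_prod, Real.finsetProd_rpow _ _ (fun i _ => norm_nonneg _)]
  rw [this]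
  exact Integrable.fintype_prod (f := fun i y => ‖hermite1 (τ i) y‖ ^ r.toReal)
    fun i => (memLp_hermite1 (τ i) r hr).integrable_norm_rpow h0 hr

lemma integral_gamma_succ {n : ℕ} (F : (Fin (n + 1) → ℝ) → ℝ) (hF : Integrable F (gamma (n + 1))) :
    ∫ x, F x ∂(gamma (n + 1)) = ∫ y, ∫ x, F (Fin.cons x y) ∂(gaussianReal 0 1) ∂(gamma n) := by
  have hmp := (measurePreserving_piFinSuccAbove
    (fun _ : Fin (n + 1) => gaussianReal 0 1) 0).symm
  have h1 := hmp.integral_comp' F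
  have h2 := hmp.integrable_comp_of_integrable hF
  change _ = ∫ x, F x ∂(gamma (n + 1)) at h1
  rw [← h1]
  refine Eq.trans (integral_prod_symm _ h2) ?_
  simp [gamma, MeasurableEquiv.piFinSuccAbove_symm_apply]
  rfl

lemma memLp_sum_hermiteFun {n : ℕ} {ι : Type*} (s : Finset ι) (a : ι → ℝ) (τ : ι → Fin n → ℕ)
    (r : ENNReal) (hr : r ≠ ⊤) :
    MemLp (fun x => ∑ j ∈ s, a j * hermiteFun (τ j) x) r (gamma n) :=
  memLp_finsetSum _ fun j _ => (memLp_hermiteFun (τ j) r hr).const_mul _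

lemma integrable_pow_four {Ω : Type*} [MeasurableSpace Ω] {μ : Measure Ω} {f : Ω → ℝ}
    (hf : MemLp f 4 μ) : Integrable (fun x => f x ^ 4) μ := by
  have h := hf.integrable_norm_pow (by norm_num : (4 : ℕ) ≠ 0)
  refine h.congr (Filter.Eventually.of_forall fun x => ?_)
  simp only [Real.norm_eq_abs]
  exact Even.pow_abs (by decide) _

/-- Gaussian hypercontractivity, from `L²` to `L⁴`, for real Hermite expansions. -/
lemma integral_sum_hermiteFun_pow_four_le (n D : ℕ) (a : (Fin n → Fin D) → ℝ) :
    ∫ x, (∑ τ, a τ * hermiteFun (fun i => (τ i : ℕ)) x) ^ 4 ∂(gamma n) ≤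
      (∑ τ, 3 ^ (∑ i, (τ i : ℕ)) * a τ ^ 2) ^ 2 := by
  induction n with
  | zero => simp [hermiteFun, ← pow_mul]
  | succ n ih =>
    -- `f j` is the coefficient of `hermite1 j` in the first variable, as a function of the others.
    -- The one-variable inequality is used with `y` frozen, Minkowski separates the `f j`, and
    -- induction bounds each of their fourth moments.
    set f : Fin D → (Fin n → ℝ) → ℝ := fun j y =>
      ∑ τ : Fin n → Fin D, a (Fin.cons j τ) * hermiteFun (fun i => (τ i : ℕ)) y
    have hf : ∀ j, MemLp (f j) 4 (gamma n) := fun j =>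
      memLp_sum_hermiteFun _ _ _ 4 (by simp)
    have hF : ∀ x y, ∑ τ : Fin (n + 1) → Fin D,
        a τ * hermiteFun (fun i => (τ i : ℕ)) (Fin.cons x y : Fin (n + 1) → ℝ) =
        ∑ j : Fin D, f j y * hermite1 j x := by
      intro x y
      rw [← (Fin.consEquiv fun _ : Fin (n + 1) => Fin D).sum_comp, Fintype.sum_prod_type]
      refine Finset.sum_congr rfl fun j _ => ?_
      rw [Finset.sum_mul]
      refine Finset.sum_congr rfl fun τ _ => ?_
      have hc : (Fin.consEquiv fun _ : Fin (n + 1) => Fin D) (j, τ) = Fin.cons j τ := rfl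
      simp only [hc, hermiteFun_eq_prod, Fin.prod_univ_succ, Fin.cons_zero,
        Fin.cons_succ]
      ring
    have h_int := integrable_pow_four (memLp_sum_hermiteFun Finset.univ a
      (fun τ i => ((τ i : Fin D) : ℕ)) 4 (by simp))
    rw [integral_gamma_succ _ h_int]
    simp_rw [hF]
    have h_int_sq : Integrable (fun y => (∑ j : Fin D, 3 ^ (j : ℕ) * f j y ^ 2) ^ 2) (gamma n) := by
      refine MemLp.integrable_sq ?_
      exact memLp_finsetSum _ fun j _ => (memLp_sq (hf j)).const_mul _
    calc ∫ y, ∫ x, (∑ j : Fin D, f j y * hermite1 j x) ^ 4 ∂(gaussianReal 0 1) ∂(gamma n)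
        ≤ ∫ y, (∑ j : Fin D, 3 ^ (j : ℕ) * f j y ^ 2) ^ 2 ∂(gamma n) := by
          refine integral_mono_of_nonneg (Filter.Eventually.of_forall fun y => ?_) h_int_sq
            (Filter.Eventually.of_forall fun y => ?_)
          · exact integral_nonneg fun x => by simp only [Pi.zero_apply]; positivity
          · exact integral_sum_hermite1_pow_four_le D fun j => f j y
      _ ≤ (∑ j : Fin D, 3 ^ (j : ℕ) * √(∫ y, f j y ^ 4 ∂(gamma n))) ^ 2 :=
          integral_sum_sq_sq_le _ _ (fun _ _ => by positivity) _ fun j _ => hf j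
      _ ≤ (∑ j : Fin D, 3 ^ (j : ℕ) *
            ∑ τ : Fin n → Fin D, 3 ^ (∑ i, (τ i : ℕ)) * a (Fin.cons j τ) ^ 2) ^ 2 := by
          gcongr with j _
          refine Real.sqrt_le_iff.2 ⟨Finset.sum_nonneg fun _ _ => by positivity, ?_⟩
          exact ih fun τ => a (Fin.cons j τ)
      _ = _ := by
          congr 1
          rw [← (Fin.consEquiv fun _ : Fin (n + 1) => Fin D).sum_comp, Fintype.sum_prod_type]
          refine Finset.sum_congr rfl fun j _ => ?_
          rw [Finset.mul_sum]
          refine Finset.sum_congr rfl fun τ _ => ?_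
          have hc : (Fin.consEquiv fun _ : Fin (n + 1) => Fin D) (j, τ) = Fin.cons j τ := rfl
          simp only [hc, Fin.sum_univ_succ, Fin.cons_zero, Fin.cons_succ, pow_add]
          ring

lemma integral_finset_sum_hermiteFun_pow_four_le {n : ℕ} (S : Finset (Fin n → ℕ))
    (a : (Fin n → ℕ) → ℝ) :
    ∫ x, (∑ τ ∈ S, a τ * hermiteFun τ x) ^ 4 ∂(gamma n) ≤
      (∑ τ ∈ S, 3 ^ (∑ i, τ i) * a τ ^ 2) ^ 2 := by
  classical
  set D : ℕ := (S.sup fun τ => ∑ i, τ i) + 1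
  have hD : ∀ τ ∈ S, ∀ i, τ i < D := fun τ hτ i => Nat.lt_succ_of_le <|
    (Finset.single_le_sum (fun _ _ => Nat.zero_le _) (Finset.mem_univ i)).trans
      (Finset.le_sup (f := fun τ : Fin n → ℕ => ∑ i, τ i) hτ)
  have key : ∀ g : (Fin n → ℕ) → ℝ, (∀ τ, τ ∉ S → g τ = 0) →
      ∑ τ : Fin n → Fin D, g (fun i => (τ i : ℕ)) = ∑ τ ∈ S, g τ := by
    intro g hg
    let e : (Fin n → Fin D) ↪ (Fin n → ℕ) :=
      ⟨fun τ i => τ i, fun τ τ' h => funext fun i => Fin.ext (congrFun h i)⟩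
    rw [show ∑ τ : Fin n → Fin D, g (fun i => (τ i : ℕ)) = ∑ τ ∈ Finset.univ.map e, g τ by
      rw [Finset.sum_map]; rfl]
    refine (Finset.sum_subset (fun τ hτ => ?_) fun τ _ hτ => hg τ hτ).symm
    exact Finset.mem_map.2 ⟨fun i => ⟨τ i, hD τ hτ i⟩, Finset.mem_univ _, rfl⟩
  have h := integral_sum_hermiteFun_pow_four_le n D
    fun τ => if (fun i => (τ i : ℕ)) ∈ S then a (fun i => (τ i : ℕ)) else 0
  have e1 : ∀ x, ∑ τ : Fin n → Fin D, (if (fun i => (τ i : ℕ)) ∈ S then a (fun i => (τ i : ℕ))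
      else 0) * hermiteFun (fun i => (τ i : ℕ)) x = ∑ τ ∈ S, a τ * hermiteFun τ x := fun x => by
    rw [key (fun τ => (if τ ∈ S then a τ else 0) * hermiteFun τ x) (fun τ h => by simp [h])]
    exact Finset.sum_congr rfl fun τ h => by simp [h]
  have e2 : ∑ τ : Fin n → Fin D, 3 ^ (∑ i, (τ i : ℕ)) * (if (fun i => (τ i : ℕ)) ∈ S then
      a (fun i => (τ i : ℕ)) else 0) ^ 2 = ∑ τ ∈ S, 3 ^ (∑ i, τ i) * a τ ^ 2 := by
    rw [key (fun τ => 3 ^ (∑ i, τ i) * (if τ ∈ S then a τ else 0) ^ 2) (fun τ h => by simp [h])]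
    exact Finset.sum_congr rfl fun τ h => by simp [h]
  simp_rw [e1] at h
  rw [e2] at h
  exact h

/-- Gaussian hypercontractivity, from `L²` to `L⁴`, for complex Hermite expansions. -/
lemma integral_norm_sum_hermiteFun_pow_four_le {n : ℕ} (S : Finset (Fin n → ℕ))
    (c : (Fin n → ℕ) → ℂ) :
    ∫ x, ‖∑ τ ∈ S, c τ * (hermiteFun τ x : ℂ)‖ ^ 4 ∂(gamma n) ≤
      (∑ τ ∈ S, 3 ^ (∑ i, τ i) * ‖c τ‖ ^ 2) ^ 2 := by
  -- Writing `|F|⁴ = (Re² + Im²)²` and applying Minkowski to the two summands passes from real to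
  -- complex coefficients without losing a constant.
  set f : Fin 2 → (Fin n → ℝ) → ℝ := ![fun x => ∑ τ ∈ S, (c τ).re * hermiteFun τ x,
    fun x => ∑ τ ∈ S, (c τ).im * hermiteFun τ x]
  have e : ∀ x, ‖∑ τ ∈ S, c τ * (hermiteFun τ x : ℂ)‖ ^ 4 = (∑ j : Fin 2, 1 * f j x ^ 2) ^ 2 := by
    intro x
    rw [show (4 : ℕ) = 2 * 2 from rfl, pow_mul, Complex.sq_norm, Complex.normSq_apply]
    simp [f, Fin.sum_univ_two, pow_two]
  simp_rw [e]
  have hf : ∀ j ∈ (Finset.univ : Finset (Fin 2)), MemLp (f j) 4 (gamma n) := by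
    intro j _
    fin_cases j
    · exact memLp_sum_hermiteFun _ _ _ 4 (by simp)
    · exact memLp_sum_hermiteFun _ _ _ 4 (by simp)
  refine (integral_sum_sq_sq_le Finset.univ (fun _ => 1) (fun _ _ => zero_le_one) f hf).trans ?_
  have hre := integral_finset_sum_hermiteFun_pow_four_le S fun τ => (c τ).re
  have him := integral_finset_sum_hermiteFun_pow_four_le S fun τ => (c τ).im
  have h1 : √(∫ x, f 0 x ^ 4 ∂(gamma n)) ≤ ∑ τ ∈ S, 3 ^ (∑ i, τ i) * (c τ).re ^ 2 :=
    Real.sqrt_le_iff.2 ⟨Finset.sum_nonneg fun _ _ => by positivity, hre⟩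
  have h2 : √(∫ x, f 1 x ^ 4 ∂(gamma n)) ≤ ∑ τ ∈ S, 3 ^ (∑ i, τ i) * (c τ).im ^ 2 :=
    Real.sqrt_le_iff.2 ⟨Finset.sum_nonneg fun _ _ => by positivity, him⟩
  refine pow_le_pow_left₀ (Finset.sum_nonneg fun _ _ => by positivity) ?_ 2
  rw [Fin.sum_univ_two, one_mul, one_mul]
  refine (add_le_add h1 h2).trans (le_of_eq ?_)
  rw [← Finset.sum_add_distrib]
  refine Finset.sum_congr rfl fun τ _ => ?_
  rw [Complex.sq_norm, Complex.normSq_apply]; ring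

end HermiteExpansions

section OrnsteinUhlenbeck

open Polynomial

/-! ### The Ornstein–Uhlenbeck operator -/

lemma measurePreserving_gaussianReal_rotation (ρ : ℝ) (hρ : ρ ^ 2 ≤ 1) :
    MeasurePreserving (fun p : ℝ × ℝ => ρ * p.1 + √(1 - ρ ^ 2) * p.2)
      ((gaussianReal 0 1).prod (gaussianReal 0 1)) (gaussianReal 0 1) := by
  refine ⟨by fun_prop, ?_⟩
  have h := gaussianReal_conv_gaussianReal (m₁ := ρ * 0) (m₂ := √(1 - ρ ^ 2) * 0)
    (v₁ := NNReal.mk (ρ ^ 2) (sq_nonneg _) * 1)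
    (v₂ := NNReal.mk (√(1 - ρ ^ 2) ^ 2) (sq_nonneg _) * 1)
  rw [← gaussianReal_map_const_mul, ← gaussianReal_map_const_mul, Measure.conv,
    Measure.map_prod_map _ _ (by fun_prop) (by fun_prop),
    Measure.map_map (by fun_prop) (by fun_prop)] at h
  refine Eq.trans ?_ (h.trans ?_)
  · rfl
  · congr 1
    · simp
    · ext
      simp only [mul_one, NNReal.coe_add, NNReal.coe_mk, NNReal.coe_one]
      rw [Real.sq_sqrt (by linarith)]; ring

/-- This makes `U_ρ f` an average of `f` over one of two independent Gaussian vectors;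
measurability, almost-everywhere linearity and `L²` contractivity of `U_ρ` follow from it. -/
lemma measurePreserving_gamma_rotation (n : ℕ) (ρ : ℝ) (hρ : ρ ^ 2 ≤ 1) :
    MeasurePreserving (fun p : (Fin n → ℝ) × (Fin n → ℝ) => ρ • p.1 + √(1 - ρ ^ 2) • p.2)
      ((gamma n).prod (gamma n)) (gamma n) := by
  have h1 := (measurePreserving_arrowProdEquivProdArrow ℝ ℝ (Fin n)
    (fun _ => gaussianReal 0 1) (fun _ => gaussianReal 0 1)).symm
  have h2 := measurePreserving_pi (fun _ : Fin n => (gaussianReal 0 1).prod (gaussianReal 0 1))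
    (fun _ : Fin n => gaussianReal 0 1)
    (fun _ => measurePreserving_gaussianReal_rotation ρ hρ)
  exact h2.comp h1

lemma aestronglyMeasurable_ornsteinUhlenbeck {n : ℕ} {ρ : ℝ} (hρ : ρ ^ 2 ≤ 1)
    {f : (Fin n → ℝ) → ℂ} (hf : AEStronglyMeasurable f (gamma n)) :
    AEStronglyMeasurable (ornsteinUhlenbeck ρ f) (gamma n) :=
  (hf.comp_measurePreserving (measurePreserving_gamma_rotation n ρ hρ)).integral_prod_right'

lemma ornsteinUhlenbeck_sub_ae {n : ℕ} {ρ : ℝ} (hρ : ρ ^ 2 ≤ 1) {f g : (Fin n → ℝ) → ℂ}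
    (hf : Integrable f (gamma n)) (hg : Integrable g (gamma n)) :
    ornsteinUhlenbeck ρ (f - g) =ᵐ[gamma n] ornsteinUhlenbeck ρ f - ornsteinUhlenbeck ρ g := by
  have h := measurePreserving_gamma_rotation n ρ hρ
  filter_upwards [(h.integrable_comp_of_integrable hf).prod_right_ae,
    (h.integrable_comp_of_integrable hg).prod_right_ae] with z hz1 hz2
  exact integral_sub hz1 hz2

/-- Jensen, in the form `L¹ ≤ L²` on each probability fibre, followed by Fubini and rotation
invariance. -/
lemma eLpNorm_ornsteinUhlenbeck_le {n : ℕ} {ρ : ℝ} (hρ : ρ ^ 2 ≤ 1) {f : (Fin n → ℝ) → ℂ}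
    (hf : AEStronglyMeasurable f (gamma n)) :
    eLpNorm (ornsteinUhlenbeck ρ f) 2 (gamma n) ≤ eLpNorm f 2 (gamma n) := by
  have h := measurePreserving_gamma_rotation n ρ hρ
  have hc := hf.comp_measurePreserving h
  rw [← eLpNorm_comp_measurePreserving hf h]
  rw [eLpNorm_eq_lintegral_rpow_enorm_toReal (by simp) (by simp),
    eLpNorm_eq_lintegral_rpow_enorm_toReal (by simp) (by simp)]
  refine ENNReal.rpow_le_rpow ?_ (by positivity)
  rw [lintegral_prod _ (hc.enorm.pow_const _)]
  refine lintegral_mono_ae ?_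
  filter_upwards [hc.prodMk_left] with z hz
  have h1 : ‖ornsteinUhlenbeck ρ f z‖ₑ ≤
      eLpNorm (fun x => f (ρ • z + √(1 - ρ ^ 2) • x)) 1 (gamma n) := by
    rw [eLpNorm_one_eq_lintegral_enorm]
    exact enorm_integral_le_lintegral_enorm _
  have h2 := h1.trans (eLpNorm_le_eLpNorm_of_exponent_le (q := 2) (by norm_num) hz)
  calc ‖ornsteinUhlenbeck ρ f z‖ₑ ^ (2 : ENNReal).toReal
      ≤ (eLpNorm (fun x => f (ρ • z + √(1 - ρ ^ 2) • x)) 2 (gamma n)) ^ (2 : ENNReal).toReal :=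
        ENNReal.rpow_le_rpow h2 (by positivity)
    _ = _ := by
        rw [eLpNorm_eq_lintegral_rpow_enorm_toReal (by simp) (by simp), ← ENNReal.rpow_mul]
        simp

/-- Hermite polynomials are eigenvectors of `U_ρ`. In `He_{k+2} = x He_{k+1} - (k+1) He_k`,
integrating the term `s X` by parts produces `s²(k+1)`; together with `-(k+1)` this leaves
`-ρ²(k+1)`, the factor required by the same recurrence at `z`. -/
lemma gaussExp_hermiteR_comp (k : ℕ) (ρ s z : ℝ) (hs : s ^ 2 = 1 - ρ ^ 2) :
    gaussExp ((hermiteR k).comp (C (ρ * z) + C s * X)) = ρ ^ k * (hermiteR k).eval z := by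
  induction k using Nat.strong_induction_on with
  | _ k ih =>
    match k with
    | 0 => simp [hermiteR_zero, gaussExp_one]
    | 1 =>
      have e : (hermiteR 1).comp (C (ρ * z) + C s * X) = (ρ * z) • 1 + s • (X * 1) := by
        rw [hermiteR_succ, hermiteR_zero]; simp [smul_eq_C_mul]
      rw [e, map_add, map_smul, map_smul, gaussExp_X_mul, gaussExp_one, hermiteR_succ,
        hermiteR_zero]
      simp
    | k + 2 =>
      have h1 := ih (k + 1) (by omega)
      have h0 := ih k (by omega)
      set l : ℝ[X] := C (ρ * z) + C s * X with hl
      have e : (hermiteR (k + 2)).comp l = (ρ * z) • (hermiteR (k + 1)).comp l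
          + s • (X * (hermiteR (k + 1)).comp l) - ((k : ℝ) + 1) • (hermiteR k).comp l := by
        rw [hermiteR_succ (k + 1), derivative_hermiteR_succ]
        simp only [sub_comp, mul_comp, X_comp, C_comp, smul_eq_C_mul]
        rw [hl]; ring
      have hd : derivative ((hermiteR (k + 1)).comp l) =
          (s * ((k : ℝ) + 1)) • (hermiteR k).comp l := by
        rw [derivative_comp, derivative_hermiteR_succ, hl]
        simp only [mul_comp, C_comp, smul_eq_C_mul, derivative_add, derivative_C, derivative_mul,
          derivative_X, C_mul]
        ring
      rw [e, map_sub, map_add, map_smul, map_smul, map_smul, gaussExp_X_mul, hd, map_smul, h1, h0,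
        hermiteR_succ (k + 1), derivative_hermiteR_succ]
      simp only [smul_eq_mul, eval_sub, eval_mul, eval_X, eval_smul]
      have : s * (s * ((k : ℝ) + 1) * (ρ ^ k * (hermiteR k).eval z)) =
          (1 - ρ ^ 2) * ((k : ℝ) + 1) * (ρ ^ k * (hermiteR k).eval z) := by
        rw [← hs]; ring
      rw [this]
      ring

lemma integral_hermite1_rotation (k : ℕ) (ρ z : ℝ) (hρ : ρ ^ 2 ≤ 1) :
    ∫ x, hermite1 k (ρ * z + √(1 - ρ ^ 2) * x) ∂(gaussianReal 0 1) = ρ ^ k * hermite1 k z := by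
  have h := gaussExp_hermiteR_comp k ρ (√(1 - ρ ^ 2)) z (Real.sq_sqrt (by linarith))
  rw [gaussExp_apply] at h
  simp only [eval_comp, eval_add, eval_C, eval_mul, eval_X, eval_hermiteR] at h
  simp only [hermite1]
  rw [integral_div, h]; ring

lemma integral_hermiteFun_rotation {n : ℕ} (τ : Fin n → ℕ) (ρ : ℝ) (z : Fin n → ℝ)
    (hρ : ρ ^ 2 ≤ 1) :
    ∫ x, hermiteFun τ (ρ • z + √(1 - ρ ^ 2) • x) ∂(gamma n) =
      ρ ^ (∑ i, τ i) * hermiteFun τ z := by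
  simp only [hermiteFun_eq_prod, Pi.add_apply, Pi.smul_apply, smul_eq_mul]
  rw [gamma, integral_fintype_prod_eq_prod
    (f := fun i y => hermite1 (τ i) (ρ * z i + √(1 - ρ ^ 2) * y))]
  simp only [integral_hermite1_rotation _ _ _ hρ]
  rw [Finset.prod_mul_distrib, Finset.prod_pow_eq_pow_sum]

lemma integrable_hermiteFun_rotation {n : ℕ} (τ : Fin n → ℕ) (ρ s : ℝ) (z : Fin n → ℝ) :
    Integrable (fun x => hermiteFun τ (ρ • z + s • x)) (gamma n) := by
  simp only [hermiteFun_eq_prod, Pi.add_apply, Pi.smul_apply, smul_eq_mul]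
  refine Integrable.fintype_prod
    (f := fun i y => hermite1 (τ i) (ρ * z i + s * y)) fun i => ?_
  have h := (integrable_eval_gaussianReal ((hermiteR (τ i)).comp (C (ρ * z i) + C s * X))).div_const
    (√((τ i).factorial : ℝ))
  simp only [eval_comp, eval_add, eval_C, eval_mul, eval_X, eval_hermiteR] at h
  exact h

/-- The action of the Ornstein–Uhlenbeck operator on finite Hermite expansions. -/
lemma ornsteinUhlenbeck_sum_hermiteFun {n : ℕ} {ρ : ℝ} (hρ : ρ ^ 2 ≤ 1) (S : Finset (Fin n → ℕ))
    (c : (Fin n → ℕ) → ℂ) (z : Fin n → ℝ) :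
    ornsteinUhlenbeck ρ (fun x => ∑ τ ∈ S, c τ * (hermiteFun τ x : ℂ)) z =
      ∑ τ ∈ S, c τ * (ρ : ℂ) ^ (∑ i, τ i) * (hermiteFun τ z : ℂ) := by
  unfold ornsteinUhlenbeck
  rw [integral_finsetSum _ fun τ _ => ((integrable_hermiteFun_rotation τ ρ _ z).ofReal).const_mul _]
  refine Finset.sum_congr rfl fun τ _ => ?_
  rw [integral_const_mul, integral_complex_ofReal, integral_hermiteFun_rotation τ ρ z hρ]
  push_cast; ring

end OrnsteinUhlenbeck

section HermiteCompleteness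

open Polynomial

/-! ### Completeness of the Hermite polynomials -/

lemma eval_eq_sum_hermiteR (p : ℝ[X]) :
    ∃ c : ℕ →₀ ℝ, ∀ x, p.eval x = ∑ k ∈ c.support, c k * hermite1 k x := by
  obtain ⟨c, hc⟩ := (Finsupp.mem_span_range_iff_exists_finsupp).1 (mem_span_hermiteR p)
  have hs : ∀ k : ℕ, √(k.factorial : ℝ) ≠ 0 := fun k =>
    Real.sqrt_ne_zero'.2 (by positivity)
  refine ⟨Finsupp.ofSupportFinite (fun k => c k * √(k.factorial : ℝ))
    (c.support.finite_toSet.subset fun k hk => ?_), fun x => ?_⟩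
  · rw [Function.mem_support] at hk
    exact Finsupp.mem_support_iff.2 (left_ne_zero_of_mul hk)
  · rw [← hc, Finsupp.sum, eval_finsetSum]
    refine Finset.sum_congr ?_ fun k _ => ?_
    · ext k
      simp [Finsupp.ofSupportFinite_coe, hs k]
    · simp only [eval_smul, eval_hermiteR, smul_eq_mul, hermite1, Finsupp.ofSupportFinite_coe]
      field_simp [hs k]

lemma prod_eval_eq_sum_hermiteFun {n : ℕ} (p : Fin n → ℝ[X]) :
    ∃ (S : Finset (Fin n → ℕ)) (a : (Fin n → ℕ) → ℝ), ∀ x : Fin n → ℝ,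
      ∏ i, (p i).eval (x i) = ∑ τ ∈ S, a τ * hermiteFun τ x := by
  choose c hc using fun i => eval_eq_sum_hermiteR (p i)
  refine ⟨Fintype.piFinset fun i => (c i).support, fun τ => ∏ i, c i (τ i), fun x => ?_⟩
  simp only [hc]
  rw [Finset.prod_univ_sum]
  refine Finset.sum_congr rfl fun τ _ => ?_
  rw [hermiteFun_eq_prod, Finset.prod_mul_distrib]

/-- Monomials are finite Hermite combinations, so `f` is orthogonal to every polynomial. Square
integrability travels with the statement because additivity of the integral needs it. -/
lemma memLp_mvPolynomial_and_integral_eq_zero {n : ℕ} {f : (Fin n → ℝ) → ℝ}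
    (hf : MemLp f 2 (gamma n)) (h0 : ∀ τ, ∫ x, hermiteFun τ x * f x ∂(gamma n) = 0)
    (q : MvPolynomial (Fin n) ℝ) :
    MemLp (fun x => MvPolynomial.eval x q) 2 (gamma n) ∧
      ∫ x, MvPolynomial.eval x q * f x ∂(gamma n) = 0 := by
  induction q using MvPolynomial.induction_on' with
  | monomial s a =>
    obtain ⟨S, b, hb⟩ := prod_eval_eq_sum_hermiteFun fun i => (X : ℝ[X]) ^ s i
    have e : ∀ x : Fin n → ℝ, MvPolynomial.eval x (MvPolynomial.monomial s a) =
        a * ∑ τ ∈ S, b τ * hermiteFun τ x := fun x => by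
      rw [MvPolynomial.eval_monomial, Finsupp.prod_fintype _ _ (by simp), ← hb]
      simp
    simp only [e]
    refine ⟨(memLp_sum_hermiteFun _ _ _ 2 (by simp)).const_mul _, ?_⟩
    have e2 : ∀ x, a * (∑ τ ∈ S, b τ * hermiteFun τ x) * f x =
        ∑ τ ∈ S, a * b τ * (hermiteFun τ x * f x) := fun x => by
      rw [Finset.mul_sum, Finset.sum_mul]
      exact Finset.sum_congr rfl fun τ _ => by ring
    simp only [e2]
    rw [integral_finsetSum]
    · refine Finset.sum_eq_zero fun τ _ => ?_
      rw [integral_const_mul, h0, mul_zero]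
    · intro τ _
      exact ((memLp_hermiteFun τ 2 (by simp)).integrable_mul hf).const_mul _
  | add p q hp hq =>
    simp only [map_add]
    refine ⟨hp.1.add hq.1, ?_⟩
    simp only [add_mul]
    refine (integral_add (hp.1.integrable_mul hf) (hq.1.integrable_mul hf)).trans ?_
    simp only [Pi.mul_apply, hp.2, hq.2, add_zero]

lemma integrable_exp_abs_mul_gaussianReal (t : ℝ) :
    Integrable (fun x => Real.exp |t * x|) (gaussianReal 0 1) := by
  refine ((integrable_exp_mul_gaussianReal t).add (integrable_exp_mul_gaussianReal (-t))).mono'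
    (by fun_prop) (Filter.Eventually.of_forall fun x => ?_)
  simp only [Pi.add_apply, Real.norm_eq_abs, Real.abs_exp]
  rcases abs_cases (t * x) with h | h <;> rw [h.1]
  · linarith [Real.exp_pos (-t * x)]
  · rw [neg_mul]; linarith [Real.exp_pos (t * x)]

/-- Supplies the dominating function for the exponential series. Its sum of absolute values factors
over the coordinates, unlike `exp |L x|`. -/
lemma memLp_exp_abs_dual {n : ℕ} (t : Fin n → ℝ) :
    MemLp (fun x : Fin n → ℝ => Real.exp (∑ i, |t i * x i|)) 2 (gamma n) := by
  have hc : Continuous fun x : Fin n → ℝ => Real.exp (∑ i, |t i * x i|) := by fun_prop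
  rw [memLp_two_iff_integrable_sq hc.aestronglyMeasurable]
  have e : (fun x : Fin n → ℝ => Real.exp (∑ i, |t i * x i|) ^ 2) =
      fun x => ∏ i, Real.exp |(2 * t i) * x i| := by
    ext x
    rw [← Real.exp_sum, ← Real.exp_nat_mul, Finset.mul_sum]
    congr 1
    refine Finset.sum_congr rfl fun i _ => ?_
    rw [mul_assoc, abs_mul]; simp
  rw [e]
  exact Integrable.fintype_prod (f := fun i y => Real.exp |(2 * t i) * y|)
    fun i => integrable_exp_abs_mul_gaussianReal _

/-- The partial sums of the exponential series are polynomials, hence orthogonal to `f`; dominated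
convergence passes to the limit. So the Fourier transform of `f · γ_n` vanishes. -/
lemma integral_cexp_mul_eq_zero {n : ℕ} {f : (Fin n → ℝ) → ℝ}
    (hf : MemLp f 2 (gamma n)) (h0 : ∀ τ, ∫ x, hermiteFun τ x * f x ∂(gamma n) = 0)
    (L : StrongDual ℝ (Fin n → ℝ)) :
    ∫ x, Complex.exp (L x * Complex.I) * (f x : ℂ) ∂(gamma n) = 0 := by
  set t : Fin n → ℝ := fun i => L (Pi.single i 1)
  have hL : ∀ x, L x = ∑ i, t i * x i := fun x => by
    conv_lhs => rw [← Finset.univ_sum_single x, map_sum]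
    refine Finset.sum_congr rfl fun i _ => ?_
    have : (Pi.single i (x i) : Fin n → ℝ) = x i • Pi.single i 1 := by
      ext j; simp [Pi.single_apply]
    rw [this, map_smul, smul_eq_mul, mul_comm]
  have hLabs : ∀ x, |L x| ≤ ∑ i, |t i * x i| := fun x => by
    rw [hL]; exact Finset.abs_sum_le_sum_abs _ _
  have hpow : ∀ k : ℕ, ∫ x, L x ^ k * f x ∂(gamma n) = 0 := fun k => by
    have h := (memLp_mvPolynomial_and_integral_eq_zero hf h0
      ((∑ i, MvPolynomial.C (t i) * MvPolynomial.X i) ^ k)).2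
    simpa [← hL] using h
  have hpowint : ∀ k : ℕ, Integrable (fun x => L x ^ k * f x) (gamma n) := fun k => by
    have h := (memLp_mvPolynomial_and_integral_eq_zero hf h0
      ((∑ i, MvPolynomial.C (t i) * MvPolynomial.X i) ^ k)).1.integrable_mul hf
    refine h.congr (Filter.Eventually.of_forall fun x => ?_)
    simp [← hL]
  set F : ℕ → (Fin n → ℝ) → ℂ := fun N x =>
    ∑ k ∈ Finset.range N, (Complex.I ^ k / (k.factorial : ℂ)) * ((L x ^ k * f x : ℝ) : ℂ)
  have hF0 : ∀ N, ∫ x, F N x ∂(gamma n) = 0 := fun N => by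
    rw [integral_finsetSum _ fun k _ => ((hpowint k).ofReal).const_mul _]
    refine Finset.sum_eq_zero fun k _ => ?_
    rw [integral_const_mul, integral_complex_ofReal, hpow]; simp
  have hFeq : ∀ N x, F N x =
      (∑ k ∈ Finset.range N, (L x * Complex.I) ^ k / (k.factorial : ℂ)) * (f x : ℂ) := fun N x => by
    rw [Finset.sum_mul]
    refine Finset.sum_congr rfl fun k _ => ?_
    push_cast; rw [mul_pow]; ring
  have hlim := tendsto_integral_of_dominated_convergence (μ := gamma n) (F := F)
    (f := fun x => Complex.exp (L x * Complex.I) * (f x : ℂ))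
    (fun x => Real.exp (∑ i, |t i * x i|) * ‖f x‖)
    (fun N => Finset.aestronglyMeasurable_fun_sum _ fun k _ =>
      (((hpowint k).ofReal).const_mul _).aestronglyMeasurable)
    ((memLp_exp_abs_dual t).integrable_mul hf.norm)
    (fun N => Filter.Eventually.of_forall fun x => by
      rw [hFeq, norm_mul, Complex.norm_real]
      refine mul_le_mul_of_nonneg_right ?_ (norm_nonneg _)
      calc ‖∑ k ∈ Finset.range N, (L x * Complex.I) ^ k / (k.factorial : ℂ)‖
          ≤ ∑ k ∈ Finset.range N, |L x| ^ k / (k.factorial : ℝ) := by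
            refine (norm_sum_le _ _).trans (Finset.sum_le_sum fun k _ => ?_)
            simp
        _ ≤ Real.exp |L x| := Real.sum_le_exp_of_nonneg (abs_nonneg _) _
        _ ≤ _ := Real.exp_le_exp.2 (hLabs x))
    (Filter.Eventually.of_forall fun x => by
      simp only [hFeq]
      refine Filter.Tendsto.mul_const _ ?_
      have h := (NormedSpace.expSeries_div_hasSum_exp (L x * Complex.I : ℂ)).tendsto_sum_nat
      rwa [← Complex.exp_eq_exp_ℂ] at h)
  simp only [hF0] at hlim
  exact tendsto_nhds_unique hlim tendsto_const_nhds

/-- A real square-integrable function orthogonal to all Hermite polynomials vanishes. -/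
lemma ae_eq_zero_of_hermite_real {n : ℕ} {f : (Fin n → ℝ) → ℝ}
    (hf : MemLp f 2 (gamma n)) (h0 : ∀ τ, ∫ x, hermiteFun τ x * f x ∂(gamma n) = 0) :
    f =ᵐ[gamma n] 0 := by
  have hfi : Integrable f (gamma n) := hf.integrable (by norm_num)
  -- The positive and negative parts of `f` are densities of two finite measures with the same
  -- characteristic function, hence of equal measures.
  set μ : Measure (Fin n → ℝ) := (gamma n).withDensity fun x => ENNReal.ofReal (f x)
  set ν : Measure (Fin n → ℝ) := (gamma n).withDensity fun x => ENNReal.ofReal (-f x)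
  have : IsFiniteMeasure μ := isFiniteMeasure_withDensity_ofReal hfi.2
  have : IsFiniteMeasure ν := isFiniteMeasure_withDensity_ofReal hfi.neg.2
  have hm1 : AEMeasurable (fun x => ENNReal.ofReal (f x)) (gamma n) :=
    hfi.1.aemeasurable.ennreal_ofReal
  have hm2 : AEMeasurable (fun x => ENNReal.ofReal (-f x)) (gamma n) :=
    hfi.1.aemeasurable.neg.ennreal_ofReal
  have hbdd : ∀ (L : StrongDual ℝ (Fin n → ℝ)) (g : (Fin n → ℝ) → ℝ), Integrable g (gamma n) →
      Integrable (fun x => g x • Complex.exp (L x * Complex.I)) (gamma n) := by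
    intro L g hg
    refine hg.norm.mono' (hg.1.smul (by fun_prop)) (Filter.Eventually.of_forall fun x => ?_)
    rw [norm_smul, Complex.norm_exp_ofReal_mul_I, mul_one]
  have hμν : μ = ν := by
    refine Measure.ext_of_charFunDual (funext fun L => ?_)
    rw [charFunDual_apply, charFunDual_apply,
      integral_withDensity_eq_integral_toReal_smul₀ hm1 (by simp),
      integral_withDensity_eq_integral_toReal_smul₀ hm2 (by simp), ← sub_eq_zero,
      ← integral_sub]
    · rw [← integral_cexp_mul_eq_zero hf h0 L]
      congr 1; ext x
      rw [← sub_smul, ENNReal.toReal_ofReal', ENNReal.toReal_ofReal',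
        max_zero_sub_max_neg_zero_eq_self,
        Complex.real_smul, mul_comm]
    · simp only [ENNReal.toReal_ofReal']
      exact hbdd L _ hfi.pos_part
    · simp only [ENNReal.toReal_ofReal']
      exact hbdd L _ hfi.neg_part
  have h := (withDensity_eq_iff hm1 hm2 (by
    have := (measure_lt_top μ Set.univ).ne
    rwa [withDensity_apply _ MeasurableSet.univ, Measure.restrict_univ] at this)).1 hμν
  filter_upwards [h] with x hx
  have := congrArg ENNReal.toReal hx
  rw [ENNReal.toReal_ofReal', ENNReal.toReal_ofReal'] at this
  have h2 := max_zero_sub_max_neg_zero_eq_self (f x)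
  simp only [Pi.zero_apply]
  linarith

lemma memLp_ofReal_hermiteFun {n : ℕ} (τ : Fin n → ℕ) (r : ENNReal) (hr : r ≠ ⊤) :
    MemLp (fun x => (hermiteFun τ x : ℂ)) r (gamma n) :=
  (memLp_hermiteFun τ r hr).ofReal

/-- A square-integrable function orthogonal to all Hermite polynomials vanishes. -/
lemma ae_eq_zero_of_hermiteCoeff {n : ℕ} {f : (Fin n → ℝ) → ℂ}
    (hf : MemLp f 2 (gamma n)) (h0 : ∀ τ, hermiteCoeff f τ = 0) : f =ᵐ[gamma n] 0 := by
  have h_int : ∀ τ, Integrable (fun x => (hermiteFun τ x : ℂ) * f x) (gamma n) := fun τ =>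
    (memLp_ofReal_hermiteFun τ 2 (by simp)).integrable_mul hf
  have hre := ae_eq_zero_of_hermite_real hf.re fun τ => by
    have h := integral_re (h_int τ)
    rw [show ∫ x, (hermiteFun τ x : ℂ) * f x ∂(gamma n) = 0 from h0 τ] at h
    simpa using h
  have him := ae_eq_zero_of_hermite_real hf.im fun τ => by
    have h := integral_im (h_int τ)
    rw [show ∫ x, (hermiteFun τ x : ℂ) * f x ∂(gamma n) = 0 from h0 τ] at h
    simpa using h
  filter_upwards [hre, him] with x h1 h2
  exact Complex.ext (by simpa using h1) (by simpa using h2)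

/-! ### Orthonormality and the Hermite basis of `L²`. -/

lemma integral_hermite1_mul_hermite1 (k l : ℕ) :
    ∫ x, hermite1 k x * hermite1 l x ∂(gaussianReal 0 1) = if k = l then 1 else 0 := by
  have h := gaussExp_hermiteR_mul_hermiteR k l
  rw [gaussExp_apply] at h
  simp only [eval_mul, eval_hermiteR] at h
  have e : ∀ x, hermite1 k x * hermite1 l x = (aeval x (hermite k) * aeval x (hermite l)) *
      (√(k.factorial : ℝ) * √(l.factorial : ℝ))⁻¹ := fun x => by
    rw [hermite1, hermite1, div_mul_div_comm, div_eq_mul_inv]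
  simp only [e]
  rw [integral_mul_const, h]
  split_ifs with hkl
  · subst hkl
    rw [Real.mul_self_sqrt (by positivity)]
    exact mul_inv_cancel₀ (by positivity)
  · simp

lemma integral_hermiteFun_mul_hermiteFun {n : ℕ} (τ τ' : Fin n → ℕ) :
    ∫ x, hermiteFun τ x * hermiteFun τ' x ∂(gamma n) = if τ = τ' then 1 else 0 := by
  simp only [hermiteFun_eq_prod, ← Finset.prod_mul_distrib]
  rw [gamma, integral_fintype_prod_eq_prod
    (f := fun i y => hermite1 (τ i) y * hermite1 (τ' i) y)]
  simp only [integral_hermite1_mul_hermite1]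
  split_ifs with h
  · simp [h]
  · obtain ⟨i, hi⟩ := Function.ne_iff.1 h
    exact Finset.prod_eq_zero (Finset.mem_univ i) (by simp [hi])

/-- The Hermite polynomials as elements of `L²`. -/
def hermiteLp {n : ℕ} (τ : Fin n → ℕ) : Lp ℂ 2 (gamma n) :=
  (memLp_ofReal_hermiteFun τ 2 (by simp)).toLp _

lemma inner_hermiteLp {n : ℕ} (τ : Fin n → ℕ) {f : (Fin n → ℝ) → ℂ} (hf : MemLp f 2 (gamma n)) :
    inner ℂ (hermiteLp τ) (hf.toLp f) = hermiteCoeff f τ := by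
  rw [L2.inner_def, hermiteCoeff]
  refine integral_congr_ae ?_
  filter_upwards [(memLp_ofReal_hermiteFun τ 2 (by simp)).coeFn_toLp, hf.coeFn_toLp] with x h1 h2
  rw [hermiteLp, h1, h2]
  simp [mul_comm]

lemma hermiteCoeff_hermiteFun {n : ℕ} (τ τ' : Fin n → ℕ) :
    hermiteCoeff (fun x => (hermiteFun τ' x : ℂ)) τ = if τ = τ' then 1 else 0 := by
  have h := integral_hermiteFun_mul_hermiteFun τ τ'
  rw [hermiteCoeff]
  simp only [← Complex.ofReal_mul]
  rw [integral_complex_ofReal, h]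
  split_ifs <;> simp

lemma orthonormal_hermiteLp (n : ℕ) : Orthonormal ℂ (hermiteLp (n := n)) := by
  classical
  rw [orthonormal_iff_ite]
  intro τ τ'
  conv_lhs => rw [hermiteLp.eq_1 τ', inner_hermiteLp, hermiteCoeff_hermiteFun]

lemma orthogonal_span_hermiteLp (n : ℕ) :
    (Submodule.span ℂ (Set.range (hermiteLp (n := n))))ᗮ = ⊥ := by
  rw [Submodule.eq_bot_iff]
  intro f hf
  have hf2 := Lp.memLp f
  have h : (f : (Fin n → ℝ) → ℂ) =ᵐ[gamma n] 0 := by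
    refine ae_eq_zero_of_hermiteCoeff hf2 fun τ => ?_
    rw [← inner_hermiteLp τ hf2, Lp.toLp_coeFn]
    exact (Submodule.mem_orthogonal _ _).1 hf _ (Submodule.subset_span ⟨τ, rfl⟩)
  exact (Lp.eq_zero_iff_ae_eq_zero).2 h

/-- The Hilbert basis of `L²(γ_n)` formed by the Hermite polynomials. -/
def hermiteBasis (n : ℕ) : HilbertBasis (Fin n → ℕ) ℂ (Lp ℂ 2 (gamma n)) :=
  HilbertBasis.mkOfOrthogonalEqBot (orthonormal_hermiteLp n) (orthogonal_span_hermiteLp n)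

lemma hermiteBasis_apply {n : ℕ} (τ : Fin n → ℕ) : hermiteBasis n τ = hermiteLp τ := by
  simp [hermiteBasis]

lemma memLp_sum_ofReal_hermiteFun {n : ℕ} (S : Finset (Fin n → ℕ)) (c : (Fin n → ℕ) → ℂ)
    (r : ENNReal) (hr : r ≠ ⊤) :
    MemLp (fun x => ∑ τ ∈ S, c τ * (hermiteFun τ x : ℂ)) r (gamma n) :=
  memLp_finsetSum _ fun τ _ => (memLp_ofReal_hermiteFun τ r hr).const_mul _

lemma sum_smul_hermiteLp {n : ℕ} (S : Finset (Fin n → ℕ)) (c : (Fin n → ℕ) → ℂ) :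
    ∑ τ ∈ S, c τ • hermiteLp τ = (memLp_sum_ofReal_hermiteFun S c 2 (by simp)).toLp _ := by
  classical
  induction S using Finset.induction_on with
  | empty => simp
  | insert τ S hτ ih =>
    rw [Finset.sum_insert hτ, ih, hermiteLp, ← MemLp.toLp_const_smul, ← MemLp.toLp_add]
    congr 1
    ext x
    simp [Finset.sum_insert hτ]

lemma norm_toLp_sq {n : ℕ} {f : (Fin n → ℝ) → ℂ} (hf : MemLp f 2 (gamma n)) :
    ‖hf.toLp f‖ ^ 2 = ∫ x, ‖f x‖ ^ 2 ∂(gamma n) := by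
  rw [← inner_self_eq_norm_sq (𝕜 := ℂ), L2.inner_def]
  have : ∫ x, inner ℂ (hf.toLp f x) (hf.toLp f x) ∂(gamma n) =
      ((∫ x, ‖f x‖ ^ 2 ∂(gamma n) : ℝ) : ℂ) := by
    rw [← integral_complex_ofReal]
    refine integral_congr_ae ?_
    filter_upwards [hf.coeFn_toLp] with x hx
    rw [hx, inner_self_eq_norm_sq_to_K]
    simp
  rw [this]
  simp

/-- Bessel's inequality for Hermite expansions. -/
lemma sum_norm_hermiteCoeff_sq_le {n : ℕ} {f : (Fin n → ℝ) → ℂ} (hf : MemLp f 2 (gamma n))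
    (S : Finset (Fin n → ℕ)) :
    ∑ τ ∈ S, ‖hermiteCoeff f τ‖ ^ 2 ≤ ∫ x, ‖f x‖ ^ 2 ∂(gamma n) := by
  have h := (orthonormal_hermiteLp n).sum_inner_products_le (hf.toLp f) (s := S)
  simpa only [inner_hermiteLp, norm_toLp_sq] using h

/-- Hermite expansions converge in `L²`. -/
lemma exists_eLpNorm_sub_hermite_le {n : ℕ} {f : (Fin n → ℝ) → ℂ} (hf : MemLp f 2 (gamma n))
    {ε : ℝ} (hε : 0 < ε) : ∃ S : Finset (Fin n → ℕ),
      eLpNorm (fun x => f x - ∑ τ ∈ S, hermiteCoeff f τ * (hermiteFun τ x : ℂ)) 2 (gamma n) ≤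
        ENNReal.ofReal ε := by
  have h := (hermiteBasis n).hasSum_repr (hf.toLp f)
  simp only [HilbertBasis.repr_apply_apply, hermiteBasis_apply, inner_hermiteLp] at h
  obtain ⟨S, hS⟩ := ((Metric.tendsto_nhds.1 h) ε hε).exists
  refine ⟨S, ?_⟩
  rw [dist_comm, sum_smul_hermiteLp, dist_eq_norm, ← MemLp.toLp_sub, Lp.norm_toLp] at hS
  refine (ENNReal.le_ofReal_iff_toReal_le ?_ hε.le).2 hS.le
  exact (hf.sub (memLp_sum_ofReal_hermiteFun S _ 2 (by simp))).eLpNorm_ne_top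

/-- Parseval's identity for finite Hermite expansions. -/
lemma integral_norm_sum_hermiteFun_sq {n : ℕ} (S : Finset (Fin n → ℕ)) (c : (Fin n → ℕ) → ℂ) :
    ∫ x, ‖∑ τ ∈ S, c τ * (hermiteFun τ x : ℂ)‖ ^ 2 ∂(gamma n) = ∑ τ ∈ S, ‖c τ‖ ^ 2 := by
  rw [← norm_toLp_sq (memLp_sum_ofReal_hermiteFun S c 2 (by simp)), ← sum_smul_hermiteLp,
    ← inner_self_eq_norm_sq (𝕜 := ℂ), (orthonormal_hermiteLp n).inner_sum, map_sum]
  refine Finset.sum_congr rfl fun τ _ => ?_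
  rw [mul_comm, Complex.mul_conj, Complex.normSq_eq_norm_sq]
  exact Complex.ofReal_re _

/-- A square-integrable function with finitely many nonzero Hermite coefficients equals its Hermite
expansion. -/
lemma ae_eq_sum_hermiteFun {n : ℕ} {f : (Fin n → ℝ) → ℂ} (hf : MemLp f 2 (gamma n))
    (S : Finset (Fin n → ℕ)) (hS : ∀ τ, τ ∉ S → hermiteCoeff f τ = 0) :
    f =ᵐ[gamma n] fun x => ∑ τ ∈ S, hermiteCoeff f τ * (hermiteFun τ x : ℂ) := by
  have h := (hermiteBasis n).hasSum_repr (hf.toLp f)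
  simp only [HilbertBasis.repr_apply_apply, hermiteBasis_apply, inner_hermiteLp] at h
  have h2 := h.unique (hasSum_sum_of_ne_finset_zero fun τ hτ => by rw [hS τ hτ, zero_smul])
  rw [sum_smul_hermiteLp, MemLp.toLp_eq_toLp_iff] at h2
  exact h2

end HermiteCompleteness

section GaussianHypercontractivity

/-! ### Hypercontractivity of the Ornstein–Uhlenbeck operator -/

lemma eLpNorm_four_eq {n : ℕ} {f : (Fin n → ℝ) → ℂ} (hf : MemLp f 4 (gamma n)) :
    eLpNorm f 4 (gamma n) = ENNReal.ofReal ((∫ x, ‖f x‖ ^ 4 ∂(gamma n)) ^ (4⁻¹ : ℝ)) := by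
  rw [hf.eLpNorm_eq_integral_rpow_norm (by simp) (by simp)]
  have h4 : (4 : ENNReal).toReal = ((4 : ℕ) : ℝ) := by simp
  simp only [h4, Real.rpow_natCast]
  norm_num

/-- The factor `3^{|τ|}` meets `ρ^{2|τ|}` from the eigenvalue. By Bessel the bound does not depend
on `S`, as the limiting argument requires. -/
lemma integral_ornsteinUhlenbeck_sum_pow_four_le {n : ℕ} {ρ : ℝ} (hρ : 3 * ρ ^ 2 ≤ 1)
    {f : (Fin n → ℝ) → ℂ} (hf : MemLp f 2 (gamma n)) (S : Finset (Fin n → ℕ)) :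
    ∫ z, ‖ornsteinUhlenbeck ρ (fun x => ∑ τ ∈ S, hermiteCoeff f τ * (hermiteFun τ x : ℂ)) z‖ ^ 4
      ∂(gamma n) ≤ (∫ x, ‖f x‖ ^ 2 ∂(gamma n)) ^ 2 := by
  have hρ1 : ρ ^ 2 ≤ 1 := by nlinarith [sq_nonneg ρ]
  simp only [ornsteinUhlenbeck_sum_hermiteFun hρ1]
  refine (integral_norm_sum_hermiteFun_pow_four_le S _).trans ?_
  refine pow_le_pow_left₀ (Finset.sum_nonneg fun _ _ => by positivity) ?_ 2
  refine le_trans (Finset.sum_le_sum fun τ _ => ?_) (sum_norm_hermiteCoeff_sq_le hf S)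
  have e : (3 : ℝ) ^ (∑ i, τ i) * ‖hermiteCoeff f τ * (ρ : ℂ) ^ (∑ i, τ i)‖ ^ 2 =
      (3 * ρ ^ 2) ^ (∑ i, τ i) * ‖hermiteCoeff f τ‖ ^ 2 := by
    rw [norm_mul, norm_pow, Complex.norm_real, Real.norm_eq_abs, mul_pow, mul_pow, ← pow_mul,
      mul_comm (∑ i, τ i) 2, pow_mul, sq_abs]
    ring
  rw [e]
  exact mul_le_of_le_one_left (by positivity) (pow_le_one₀ (by positivity) hρ)

/-- Gaussian hypercontractivity: `U_ρ` is a contraction from `L²` to `L⁴` if `3 ρ² ≤ 1`. -/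
theorem ornsteinUhlenbeck_hypercontractive {n : ℕ} {ρ : ℝ} (hρ : 3 * ρ ^ 2 ≤ 1)
    {f : (Fin n → ℝ) → ℂ} (hf : MemLp f 2 (gamma n)) :
    MemLp (ornsteinUhlenbeck ρ f) 4 (gamma n) ∧
      ∫ z, ‖ornsteinUhlenbeck ρ f z‖ ^ 4 ∂(gamma n) ≤ (∫ x, ‖f x‖ ^ 2 ∂(gamma n)) ^ 2 := by
  have hρ1 : ρ ^ 2 ≤ 1 := by nlinarith [sq_nonneg ρ]
  choose S hS using fun k : ℕ => exists_eLpNorm_sub_hermite_le hf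
    (Nat.one_div_pos_of_nat (α := ℝ) (n := k))
  set g : ℕ → (Fin n → ℝ) → ℂ := fun k x =>
    ∑ τ ∈ S k, hermiteCoeff f τ * (hermiteFun τ x : ℂ)
  have hg : ∀ k, MemLp (g k) 2 (gamma n) := fun k => memLp_sum_ofReal_hermiteFun _ _ _ (by simp)
  have hUg : ∀ k, MemLp (ornsteinUhlenbeck ρ (g k)) 4 (gamma n) := fun k => by
    simp only [g, funext (ornsteinUhlenbeck_sum_hermiteFun hρ1 (S k) (hermiteCoeff f))]
    exact memLp_sum_ofReal_hermiteFun _ _ _ (by simp)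
  have hUf := aestronglyMeasurable_ornsteinUhlenbeck hρ1 hf.1
  have hconv : Filter.Tendsto (fun k =>
      eLpNorm (ornsteinUhlenbeck ρ (g k) - ornsteinUhlenbeck ρ f) 2 (gamma n))
      Filter.atTop (nhds 0) := by
    have hlim : Filter.Tendsto (fun k : ℕ => ENNReal.ofReal (1 / ((k : ℝ) + 1))) Filter.atTop
        (nhds 0) := by
      simpa using ENNReal.tendsto_ofReal (tendsto_one_div_add_atTop_nhds_zero_nat (𝕜 := ℝ))
    refine tendsto_of_tendsto_of_tendsto_of_le_of_le tendsto_const_nhds hlim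
      (fun _ => zero_le) fun k => ?_
    simp only
    rw [eLpNorm_sub_comm, ← eLpNorm_congr_ae (ornsteinUhlenbeck_sub_ae hρ1
      (hf.integrable (by norm_num)) ((hg k).integrable (by norm_num)))]
    exact (eLpNorm_ornsteinUhlenbeck_le hρ1 (hf.1.sub (hg k).1)).trans (hS k)
  -- Convergence in `L²` gives an almost everywhere convergent subsequence, along which Fatou
  -- transfers the uniform `L⁴` bound to the limit.
  obtain ⟨ns, -, hns⟩ := (tendstoInMeasure_of_tendsto_eLpNorm two_ne_zero
    (fun k => (hUg k).1) hUf hconv).exists_seq_tendsto_ae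
  set A := ∫ x, ‖f x‖ ^ 2 ∂(gamma n)
  have hA : 0 ≤ A := integral_nonneg fun x => by positivity
  have hle : eLpNorm (ornsteinUhlenbeck ρ f) 4 (gamma n) ≤
      ENNReal.ofReal ((A ^ 2) ^ (4⁻¹ : ℝ)) := by
    refine (Lp.eLpNorm_lim_le_liminf_eLpNorm (fun k => (hUg (ns k)).1) _ hns).trans ?_
    refine Filter.liminf_le_of_le (by isBoundedDefault) fun b hb => ?_
    obtain ⟨k, hk⟩ := hb.exists
    refine hk.trans ?_
    rw [eLpNorm_four_eq (hUg _)]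
    refine ENNReal.ofReal_le_ofReal (Real.rpow_le_rpow (integral_nonneg fun x => by positivity) ?_
      (by positivity))
    exact integral_ornsteinUhlenbeck_sum_pow_four_le hρ hf _
  have hmem : MemLp (ornsteinUhlenbeck ρ f) 4 (gamma n) :=
    ⟨hUf, hle.trans_lt ENNReal.ofReal_lt_top⟩
  refine ⟨hmem, ?_⟩
  rw [eLpNorm_four_eq hmem, ENNReal.ofReal_le_ofReal_iff (by positivity)] at hle
  exact (Real.rpow_le_rpow_iff (integral_nonneg fun x => by positivity) (by positivity)
    (by norm_num)).1 hle

end GaussianHypercontractivity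

section DepolarizingNoise

open Matrix

/-! ### Hypercontractivity of the depolarizing noise -/

/-! ### Schatten 4-norms through the Frobenius inner product. -/

section Frobenius

variable {ι : Type*} [Fintype ι]

/-- A matrix as a vector of the Euclidean space of its entries. -/
def matVec : Matrix ι ι ℂ →ₗ[ℂ] EuclideanSpace ℂ (ι × ι) where
  toFun A := WithLp.toLp 2 fun p => A p.1 p.2
  map_add' _ _ := rfl
  map_smul' _ _ := rfl

lemma norm_matVec_sq (A : Matrix ι ι ℂ) : ‖matVec A‖ ^ 2 = ∑ i, ∑ j, ‖A i j‖ ^ 2 := by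
  rw [EuclideanSpace.norm_sq_eq, Fintype.sum_prod_type]; rfl

lemma inner_matVec (A B : Matrix ι ι ℂ) :
    inner ℂ (matVec A) (matVec B) = (Aᴴ * B).trace := by
  rw [PiLp.inner_apply, Fintype.sum_prod_type, Finset.sum_comm, Matrix.trace]
  refine Finset.sum_congr rfl fun i _ => ?_
  rw [Matrix.diag_apply, Matrix.mul_apply]
  refine Finset.sum_congr rfl fun j _ => ?_
  change inner ℂ (A j i) (B j i) = _
  simp [mul_comm]

lemma norm_matVec_sq_eq_trace (A : Matrix ι ι ℂ) : (‖matVec A‖ ^ 2 : ℝ) = (Aᴴ * A).trace.re := by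
  rw [← inner_matVec]
  exact (inner_self_eq_norm_sq (𝕜 := ℂ) _).symm

/-- The square of the (unnormalized) Schatten 4-norm. -/
def fourNormSq (A : Matrix ι ι ℂ) : ℝ := ‖matVec (Aᴴ * A)‖

lemma fourNormSq_nonneg (A : Matrix ι ι ℂ) : 0 ≤ fourNormSq A := norm_nonneg _

lemma norm_matVec_mul_conjTranspose_self (A : Matrix ι ι ℂ) :
    ‖matVec (A * Aᴴ)‖ = fourNormSq A := by
  rw [fourNormSq, ← sq_eq_sq₀ (norm_nonneg _) (norm_nonneg _), norm_matVec_sq_eq_trace,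
    norm_matVec_sq_eq_trace]
  simp only [conjTranspose_mul, conjTranspose_conjTranspose]
  rw [Matrix.mul_assoc, Matrix.trace_mul_comm]
  simp only [Matrix.mul_assoc]

/-- Hölder's inequality `‖A† B‖_2 ≤ ‖A‖_4 ‖B‖_4`. -/
lemma norm_matVec_conjTranspose_mul_sq_le (A B : Matrix ι ι ℂ) :
    ‖matVec (Aᴴ * B)‖ ^ 2 ≤ fourNormSq A * fourNormSq B := by
  rw [← norm_matVec_mul_conjTranspose_self A, ← norm_matVec_mul_conjTranspose_self B]
  refine le_trans (le_of_eq ?_) (re_inner_le_norm (𝕜 := ℂ) (matVec (A * Aᴴ)) (matVec (B * Bᴴ)))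
  rw [norm_matVec_sq_eq_trace, inner_matVec]
  simp only [conjTranspose_mul, conjTranspose_conjTranspose]
  rw [show Bᴴ * A * (Aᴴ * B) = Bᴴ * (A * Aᴴ * B) by simp only [Matrix.mul_assoc],
    Matrix.trace_mul_comm, show A * Aᴴ * B * Bᴴ = A * Aᴴ * (B * Bᴴ) by
      simp only [Matrix.mul_assoc]]
  rfl

end Frobenius

/-- Young's inequality with weights `1 + 1/2` and `1 + 2`. The choice yields the coefficients `8 = 2
+ (3/2) · 4` and `3` of the block estimate. -/
lemma norm_add_sq_le_three {E : Type*} [NormedAddCommGroup E] [InnerProductSpace ℂ E] (a b : E) :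
    ‖a + b‖ ^ 2 ≤ 3 / 2 * ‖a‖ ^ 2 + 3 * ‖b‖ ^ 2 := by
  have h := norm_add_le a b
  nlinarith [norm_nonneg a, norm_nonneg b, norm_nonneg (a + b), sq_nonneg (‖a‖ - 2 * ‖b‖)]

lemma norm_add_sq_le_two {E : Type*} [NormedAddCommGroup E] [InnerProductSpace ℂ E] (a b : E) :
    ‖a + b‖ ^ 2 ≤ 2 * ‖a‖ ^ 2 + 2 * ‖b‖ ^ 2 := by
  have h := norm_add_le a b
  nlinarith [norm_nonneg a, norm_nonneg b, norm_nonneg (a + b), sq_nonneg (‖a‖ - ‖b‖)]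

/-! ### Fourth moments of block matrices. -/

section Blocks

variable {ι κ : Type*} [Fintype ι] [Fintype κ]

/-- Hölder bounds each summand by `√` of 4-norms; Cauchy–Schwarz in `s` then leaves a product of a
function of `t` and a function of `u`. -/
lemma sum_norm_block_gram_sq_le (Y : κ → κ → Matrix ι ι ℂ) :
    ∑ t, ∑ u, ‖matVec (∑ s, (Y s t)ᴴ * Y s u)‖ ^ 2 ≤ (∑ s, ∑ t, fourNormSq (Y s t)) ^ 2 := by
  rw [Finset.sum_comm (f := fun s t => fourNormSq (Y s t)), pow_two, Finset.sum_mul_sum]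
  refine Finset.sum_le_sum fun t _ => Finset.sum_le_sum fun u _ => ?_
  have h : ‖matVec (∑ s, (Y s t)ᴴ * Y s u)‖ ≤
      ∑ s, √(fourNormSq (Y s t)) * √(fourNormSq (Y s u)) := by
    rw [map_sum]
    refine (norm_sum_le _ _).trans (Finset.sum_le_sum fun s _ => ?_)
    rw [← Real.sqrt_mul (fourNormSq_nonneg _)]
    exact Real.le_sqrt_of_sq_le (norm_matVec_conjTranspose_mul_sq_le _ _)
  refine (pow_le_pow_left₀ (norm_nonneg _) h 2).trans ?_
  refine (Finset.sum_mul_sq_le_sq_mul_sq _ _ _).trans (le_of_eq ?_)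
  simp only [Real.sq_sqrt (fourNormSq_nonneg _)]

/-- The fourth moment of `1 ⊗ X + ρ Y`, where the partial trace of `Y` vanishes. -/
lemma sum_norm_perturbed_gram_sq_le [DecidableEq κ] (ρ : ℝ) (X : Matrix ι ι ℂ)
    (Y : κ → κ → Matrix ι ι ℂ)
    (hY : ∑ s, Y s s = 0) (W : κ → κ → Matrix ι ι ℂ)
    (hW : ∀ s t, W s t = (if s = t then X else 0) + (ρ : ℂ) • Y s t) :
    ∑ t, ∑ u, ‖matVec (∑ s, (W s t)ᴴ * W s u)‖ ^ 2 ≤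
      Fintype.card κ * fourNormSq X ^ 2 +
        8 * ρ ^ 2 * (fourNormSq X * ∑ s, ∑ t, fourNormSq (Y s t)) +
        3 * ρ ^ 4 * (∑ s, ∑ t, fourNormSq (Y s t)) ^ 2 := by
  set S := ∑ s, ∑ t, fourNormSq (Y s t) with hS
  set C : κ → κ → Matrix ι ι ℂ := fun t u => Xᴴ * Y t u + (Y u t)ᴴ * X
  set D : κ → κ → Matrix ι ι ℂ := fun t u => ∑ s, (Y s t)ᴴ * Y s u
  -- Orders zero, one and two in `ρ` of the Gram matrix.
  have hG : ∀ t u, ∑ s, (W s t)ᴴ * W s u =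
      (if t = u then Xᴴ * X else 0) + ((ρ : ℂ) • C t u + ((ρ : ℂ) ^ 2) • D t u) := by
    intro t u
    have e : ∀ s, (W s t)ᴴ * W s u = (if s = t then (if s = u then Xᴴ * X else 0) else 0) +
        (if s = t then (ρ : ℂ) • (Xᴴ * Y s u) else 0) +
        (if s = u then (ρ : ℂ) • ((Y s t)ᴴ * X) else 0) +
        ((ρ : ℂ) ^ 2) • ((Y s t)ᴴ * Y s u) := by
      intro s
      have hc : star (ρ : ℂ) = ρ := Complex.conj_ofReal ρ
      rw [hW, hW, conjTranspose_add, conjTranspose_smul, hc]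
      split_ifs <;>
        simp only [Matrix.add_mul, Matrix.mul_add, Matrix.smul_mul, Matrix.mul_smul,
          conjTranspose_zero, Matrix.zero_mul, Matrix.mul_zero] <;> module
    simp only [e, Finset.sum_add_distrib, Finset.sum_ite_eq', Finset.mem_univ, if_true,
      ← Finset.smul_sum, C, D, smul_add]
    abel
  have hexp : ∀ t u, ‖matVec (∑ s, (W s t)ᴴ * W s u)‖ ^ 2 =
      (if t = u then fourNormSq X ^ 2 else 0) +
      (if t = u then 2 * (inner ℂ (matVec (Xᴴ * X))
        (matVec ((ρ : ℂ) • C t u + ((ρ : ℂ) ^ 2) • D t u))).re else 0) +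
      ‖matVec ((ρ : ℂ) • C t u + ((ρ : ℂ) ^ 2) • D t u)‖ ^ 2 := by
    intro t u
    rw [hG]
    split_ifs
    · rw [map_add, norm_add_sq (𝕜 := ℂ)]; rfl
    · simp
  -- Summed over the diagonal, the first-order term sees only the partial trace of `Y`. Only `D`
  -- therefore pairs with `Xᴴ * X`, and no odd power of `ρ` survives.
  have hC : ∑ t, C t t = 0 := by
    simp only [C, Finset.sum_add_distrib, ← Finset.mul_sum, ← Finset.sum_mul,
      ← Matrix.conjTranspose_sum, hY]
    simp
  have hmid : ∑ t, 2 * (inner ℂ (matVec (Xᴴ * X))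
      (matVec ((ρ : ℂ) • C t t + ((ρ : ℂ) ^ 2) • D t t))).re ≤ 2 * ρ ^ 2 * (fourNormSq X * S) := by
    have e : ∑ t, 2 * (inner ℂ (matVec (Xᴴ * X))
        (matVec ((ρ : ℂ) • C t t + ((ρ : ℂ) ^ 2) • D t t))).re =
        2 * ρ ^ 2 * ∑ s, ∑ t, (inner ℂ (matVec (Xᴴ * X)) (matVec ((Y s t)ᴴ * Y s t))).re := by
      rw [← Finset.mul_sum, ← Complex.re_sum, ← inner_sum, ← map_sum, Finset.sum_add_distrib,
        ← Finset.smul_sum, hC, smul_zero, zero_add, ← Finset.smul_sum, map_smul, inner_smul_right,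
        ← Complex.ofReal_pow, Complex.re_ofReal_mul, Finset.sum_comm (s := Finset.univ)]
      simp only [map_sum, inner_sum, Complex.re_sum]
      ring
    rw [e]
    refine mul_le_mul_of_nonneg_left ?_ (by positivity)
    rw [hS, Finset.mul_sum]
    refine Finset.sum_le_sum fun s _ => ?_
    rw [Finset.mul_sum]
    exact Finset.sum_le_sum fun t _ => re_inner_le_norm (𝕜 := ℂ) _ _
  have hCsq : ∑ t, ∑ u, ‖matVec (C t u)‖ ^ 2 ≤ 4 * (fourNormSq X * S) := by
    have h1 : ∀ t u, ‖matVec (C t u)‖ ^ 2 ≤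
        2 * (fourNormSq X * fourNormSq (Y t u)) + 2 * (fourNormSq X * fourNormSq (Y u t)) := by
      intro t u
      simp only [C, map_add]
      refine (norm_add_sq_le_two _ _).trans (add_le_add ?_ ?_)
      · exact mul_le_mul_of_nonneg_left (norm_matVec_conjTranspose_mul_sq_le _ _) (by norm_num)
      · rw [mul_comm (fourNormSq X)]
        exact mul_le_mul_of_nonneg_left (norm_matVec_conjTranspose_mul_sq_le _ _) (by norm_num)
    refine (Finset.sum_le_sum fun t _ => Finset.sum_le_sum fun u _ => h1 t u).trans
      (le_of_eq ?_)
    simp only [Finset.sum_add_distrib, ← Finset.mul_sum]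
    rw [Finset.sum_comm (f := fun t u => fourNormSq (Y u t)), ← hS]
    ring
  have hlast : ∑ t, ∑ u, ‖matVec ((ρ : ℂ) • C t u + ((ρ : ℂ) ^ 2) • D t u)‖ ^ 2 ≤
      3 / 2 * ρ ^ 2 * (4 * (fourNormSq X * S)) + 3 * ρ ^ 4 * S ^ 2 := by
    have h1 : ∀ t u, ‖matVec ((ρ : ℂ) • C t u + ((ρ : ℂ) ^ 2) • D t u)‖ ^ 2 ≤
        3 / 2 * ρ ^ 2 * ‖matVec (C t u)‖ ^ 2 + 3 * ρ ^ 4 * ‖matVec (D t u)‖ ^ 2 := by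
      intro t u
      rw [map_add, map_smul, map_smul]
      refine (norm_add_sq_le_three _ _).trans (le_of_eq ?_)
      rw [norm_smul, norm_smul, norm_pow, Complex.norm_real, Real.norm_eq_abs, mul_pow, mul_pow,
        sq_abs]
      ring
    refine (Finset.sum_le_sum fun t _ => Finset.sum_le_sum fun u _ => h1 t u).trans ?_
    simp only [Finset.sum_add_distrib, ← Finset.mul_sum]
    exact add_le_add (mul_le_mul_of_nonneg_left hCsq (by positivity))
      (mul_le_mul_of_nonneg_left (sum_norm_block_gram_sq_le Y) (by positivity))
  simp only [hexp, Finset.sum_add_distrib, Finset.sum_ite_eq, Finset.mem_univ, if_true,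
    Finset.sum_const, Finset.card_univ, nsmul_eq_mul]
  linarith

/-- Pythagoras: a matrix with zero partial trace is orthogonal to every `1 ⊗ Q`. -/
lemma sum_norm_perturbed_sq [DecidableEq κ] (Q : Matrix ι ι ℂ) (R : κ → κ → Matrix ι ι ℂ)
    (hR : ∑ s, R s s = 0) (P : κ → κ → Matrix ι ι ℂ)
    (hP : ∀ s t, P s t = (if s = t then Q else 0) + R s t) :
    ∑ s, ∑ t, ‖matVec (P s t)‖ ^ 2 =
      Fintype.card κ * ‖matVec Q‖ ^ 2 + ∑ s, ∑ t, ‖matVec (R s t)‖ ^ 2 := by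
  have e : ∀ s t, ‖matVec (P s t)‖ ^ 2 = (if s = t then ‖matVec Q‖ ^ 2 else 0) +
      (if s = t then 2 * (inner ℂ (matVec Q) (matVec (R s t))).re else 0) +
      ‖matVec (R s t)‖ ^ 2 := by
    intro s t
    rw [hP]
    split_ifs
    · rw [map_add, norm_add_sq (𝕜 := ℂ)]; rfl
    · simp
  simp only [e, Finset.sum_add_distrib, Finset.sum_ite_eq, Finset.mem_univ, if_true,
    Finset.sum_const, Finset.card_univ, nsmul_eq_mul, ← Finset.mul_sum,
    ← Complex.re_sum, ← inner_sum, ← map_sum, hR]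
  simp

end Blocks

/-! ### Induction on the number of registers. -/

variable {m h : ℕ}

/-- The block of a matrix on `h + 1` registers with given indices of the first register. -/
def blk (s t : Fin m) (A : TensorMat m (h + 1)) : TensorMat m h :=
  Matrix.of fun a b => A (Fin.cons s a) (Fin.cons t b)

lemma sum_cons {M : Type*} [AddCommMonoid M] (f : (Fin (h + 1) → Fin m) → M) :
    ∑ a, f a = ∑ s, ∑ a : Fin h → Fin m, f (Fin.cons s a) := by
  rw [← (Fin.consEquiv fun _ : Fin (h + 1) => Fin m).sum_comp, Fintype.sum_prod_type]
  rfl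

lemma norm_matVec_sq_blk (A : TensorMat m (h + 1)) :
    ‖matVec A‖ ^ 2 = ∑ s, ∑ t, ‖matVec (blk s t A)‖ ^ 2 := by
  simp only [norm_matVec_sq, sum_cons]
  refine Finset.sum_congr rfl fun s _ => ?_
  rw [Finset.sum_comm]
  rfl

lemma blk_conjTranspose_mul_self (A : TensorMat m (h + 1)) (t u : Fin m) :
    blk t u (Aᴴ * A) = ∑ s, (blk s t A)ᴴ * blk s u A := by
  ext a b
  simp only [blk, Matrix.of_apply, Matrix.mul_apply, Matrix.sum_apply, sum_cons]
  rfl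

lemma fourNormSq_sq_blk (A : TensorMat m (h + 1)) :
    fourNormSq A ^ 2 = ∑ t, ∑ u, ‖matVec (∑ s, (blk s t A)ᴴ * blk s u A)‖ ^ 2 := by
  rw [fourNormSq, norm_matVec_sq_blk]
  simp only [blk_conjTranspose_mul_self]

lemma depolarizeAt_apply (ρ : ℝ) (k : Fin h) (P : TensorMat m h) (a b : Fin h → Fin m) :
    depolarizeAt ρ k P a b = (ρ : ℂ) * P a b + (((1 - ρ) / m : ℝ) : ℂ) *
      (∑ s, P (Function.update a k s) (Function.update b k s)) * (if a k = b k then 1 else 0) := by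
  simp only [depolarizeAt, depolarize, Matrix.of_apply, Matrix.add_apply, Matrix.smul_apply,
    Function.update_eq_self, smul_eq_mul, Matrix.one_apply, Matrix.trace, Matrix.diag_apply]

/-- `depolarizeAt` as a linear map. -/
def depolarizeAtLin (ρ : ℝ) (k : Fin h) : TensorMat m h →ₗ[ℂ] TensorMat m h where
  toFun := depolarizeAt ρ k
  map_add' P Q := by
    ext a b
    simp only [depolarizeAt_apply, Matrix.add_apply, Finset.sum_add_distrib]; ring
  map_smul' c P := by
    ext a b
    simp only [depolarizeAt_apply, Matrix.smul_apply, smul_eq_mul, ← Finset.mul_sum,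
      RingHom.id_apply]
    ring

/-- `depolarizeAll` as a linear map. -/
def depolarizeAllLin (m h : ℕ) (ρ : ℝ) : TensorMat m h →ₗ[ℂ] TensorMat m h :=
  (List.finRange h).foldr (fun k T => depolarizeAtLin ρ k ∘ₗ T) LinearMap.id

lemma depolarizeAllLin_apply (ρ : ℝ) (P : TensorMat m h) :
    depolarizeAllLin m h ρ P = depolarizeAll ρ P := by
  unfold depolarizeAllLin depolarizeAll
  induction List.finRange h with
  | nil => rfl
  | cons k l ih =>
    simp only [List.foldr_cons, LinearMap.comp_apply, ih]
    rfl

lemma blk_depolarizeAt_succ (ρ : ℝ) (k : Fin h) (A : TensorMat m (h + 1)) (s t : Fin m) :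
    blk s t (depolarizeAt ρ k.succ A) = depolarizeAt ρ k (blk s t A) := by
  ext a b
  simp only [blk, Matrix.of_apply, depolarizeAt_apply, Fin.cons_succ, ← Fin.cons_update]

lemma blk_depolarizeAt_zero (ρ : ℝ) (A : TensorMat m (h + 1)) (s t : Fin m) :
    blk s t (depolarizeAt ρ 0 A) = (ρ : ℂ) • blk s t A +
      if s = t then (((1 - ρ) / m : ℝ) : ℂ) • ∑ u, blk u u A else 0 := by
  ext a b
  split_ifs with hst <;>
  simp [blk, depolarizeAt_apply, Fin.update_cons_zero, Matrix.sum_apply, hst]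

/-- Noise on the later registers acts inside each block; noise on the first register is the
outermost map of the fold and only recombines blocks. -/
lemma blk_depolarizeAll (ρ : ℝ) (A : TensorMat m (h + 1)) (s t : Fin m) :
    blk s t (depolarizeAll ρ A) = (ρ : ℂ) • depolarizeAll ρ (blk s t A) +
      if s = t then (((1 - ρ) / m : ℝ) : ℂ) • ∑ u, depolarizeAll ρ (blk u u A) else 0 := by
  have hl : ∀ (s t : Fin m), blk s t (((List.finRange h).map Fin.succ).foldr
      (fun k Q => depolarizeAt ρ k Q) A) = depolarizeAll ρ (blk s t A) := by
    intro s t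
    unfold depolarizeAll
    induction List.finRange h with
    | nil => rfl
    | cons k l ih => simp only [List.map_cons, List.foldr_cons, blk_depolarizeAt_succ, ih]
  conv_lhs => rw [depolarizeAll, List.finRange_succ, List.foldr_cons]
  rw [blk_depolarizeAt_zero]
  simp only [hl]

/-- Coefficientwise comparison: the `x * S` terms need `8ρ² ≤ 2`, the `S²` terms need `3ρ⁴M ≤ 1`,
and the `x²` terms agree. -/
lemma noise_quadratic_le {M x S ρ : ℝ} (hM : 0 ≤ M) (hx : 0 ≤ x) (hS : 0 ≤ S)
    (h1 : 4 * ρ ^ 2 ≤ 1) (h2 : 3 * ρ ^ 4 * M ≤ 1) :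
    M * (M * x ^ 2 + 8 * ρ ^ 2 * (x * S) + 3 * ρ ^ 4 * S ^ 2) ≤ (M * x + S) ^ 2 := by
  have e1 := mul_le_mul_of_nonneg_right h1 (by positivity : 0 ≤ 2 * (M * (x * S)))
  have e2 := mul_le_mul_of_nonneg_right h2 (sq_nonneg S)
  linarith

/-- Hypercontractivity of the depolarizing noise, unnormalized. -/
lemma card_mul_fourNormSq_depolarizeAll_sq_le {ρ : ℝ} (hm : 0 < m) (h1 : 4 * ρ ^ 2 ≤ 1)
    (h2 : 3 * ρ ^ 4 * m ≤ 1) (A : TensorMat m h) :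
    (m : ℝ) ^ h * fourNormSq (depolarizeAll ρ A) ^ 2 ≤ (‖matVec A‖ ^ 2) ^ 2 := by
  have hm' : (0 : ℝ) < m := by exact_mod_cast hm
  induction h with
  | zero =>
    have e : depolarizeAll ρ A = A := rfl
    rw [e, pow_zero, one_mul, fourNormSq]
    have h := norm_matVec_sq A
    have h' := norm_matVec_sq (Aᴴ * A)
    simp only [Fintype.sum_unique, Matrix.mul_apply, norm_mul, conjTranspose_apply, norm_star]
      at h h'
    rw [h, h']
    exact le_of_eq (by ring)
  | succ h ih =>
    -- `Q` is the normalized partial trace over the first register, so `R`, the blocks of `A - 1 ⊗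
    -- Q`, has zero partial trace.
    set Q : TensorMat m h := ((m : ℂ)⁻¹) • ∑ u, blk u u A with hQ
    set R : Fin m → Fin m → TensorMat m h := fun s t => blk s t A - if s = t then Q else 0 with hR
    have hmc : (m : ℂ) ≠ 0 := by exact_mod_cast hm.ne'
    have hmQ : (m : ℂ) • Q = ∑ u, blk u u A := by
      rw [hQ, smul_smul, mul_inv_cancel₀ hmc, one_smul]
    have hR0 : ∑ s, R s s = 0 := by
      simp only [hR, if_true, Finset.sum_sub_distrib, Finset.sum_const, Finset.card_univ,
        Fintype.card_fin]
      rw [← hmQ, ← Nat.cast_smul_eq_nsmul ℂ, sub_self]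
    set X := depolarizeAll ρ Q with hX
    set Y : Fin m → Fin m → TensorMat m h := fun s t => depolarizeAll ρ (R s t) with hY
    have hY0 : ∑ s, Y s s = 0 := by
      simp only [hY, ← depolarizeAllLin_apply, ← map_sum, hR0, map_zero]
    have hW : ∀ s t, blk s t (depolarizeAll ρ A) = (if s = t then X else 0) + (ρ : ℂ) • Y s t := by
      intro s t
      rw [blk_depolarizeAll]
      have e : ∑ u, depolarizeAll ρ (blk u u A) = (m : ℂ) • X := by
        simp only [hX, ← depolarizeAllLin_apply, ← map_sum, ← map_smul, hmQ]
      rw [e]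
      simp only [hY, hR, hX, ← depolarizeAllLin_apply, map_sub]
      split_ifs
      · rw [smul_smul]
        have : (((1 - ρ) / m : ℝ) : ℂ) * m = 1 - ρ := by
          push_cast; field_simp
        rw [this]
        module
      · simp
    have key := sum_norm_perturbed_gram_sq_le ρ X Y hY0 _ hW
    rw [← fourNormSq_sq_blk, Fintype.card_fin] at key
    set x := fourNormSq X
    set S := ∑ s, ∑ t, fourNormSq (Y s t) with hS
    have hx0 : 0 ≤ x := fourNormSq_nonneg _
    have hS0 : 0 ≤ S := Finset.sum_nonneg fun _ _ => Finset.sum_nonneg fun _ _ =>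
      fourNormSq_nonneg _
    -- Taking square roots makes the induction hypothesis linear in `fourNormSq`, so it can be
    -- summed over the blocks of `R`.
    set c := √((m : ℝ) ^ h) with hc
    have hc0 : 0 ≤ c := Real.sqrt_nonneg _
    have hc2 : c ^ 2 = (m : ℝ) ^ h := Real.sq_sqrt (by positivity)
    have hih : ∀ B : TensorMat m h, c * fourNormSq (depolarizeAll ρ B) ≤ ‖matVec B‖ ^ 2 := by
      intro B
      refine le_of_sq_le_sq ?_ (by positivity)
      rw [mul_pow, hc2]
      exact ih B
    have hcx : c * x ≤ ‖matVec Q‖ ^ 2 := hih Q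
    have hcS : c * S ≤ ∑ s, ∑ t, ‖matVec (R s t)‖ ^ 2 := by
      rw [hS, Finset.mul_sum]
      refine Finset.sum_le_sum fun s _ => ?_
      rw [Finset.mul_sum]
      exact Finset.sum_le_sum fun t _ => hih _
    have hnorm : ‖matVec A‖ ^ 2 = m * ‖matVec Q‖ ^ 2 + ∑ s, ∑ t, ‖matVec (R s t)‖ ^ 2 := by
      have h := sum_norm_perturbed_sq Q R hR0 (fun s t => blk s t A) fun s t => by simp [hR]
      rwa [← norm_matVec_sq_blk, Fintype.card_fin] at h
    have hfin : (m : ℝ) ^ (h + 1) * fourNormSq (depolarizeAll ρ A) ^ 2 ≤ (c * (m * x + S)) ^ 2 := by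
      rw [mul_pow, hc2, pow_succ, mul_assoc]
      refine mul_le_mul_of_nonneg_left ?_ (by positivity)
      refine (mul_le_mul_of_nonneg_left key hm'.le).trans ?_
      exact noise_quadratic_le hm'.le hx0 hS0 h1 h2
    refine hfin.trans (pow_le_pow_left₀
      (mul_nonneg hc0 (add_nonneg (mul_nonneg hm'.le hx0) hS0)) ?_ 2)
    rw [hnorm, mul_add]
    refine add_le_add ?_ hcS
    rw [mul_left_comm]
    exact mul_le_mul_of_nonneg_left hcx hm'.le

end DepolarizingNoise

section TensorBasis

open Matrix

/-! ### Normalized norms -/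

section NormalizedNorm

variable {ι : Type*} [Fintype ι] [DecidableEq ι]

lemma trace_toEuclideanLin (M : Matrix ι ι ℂ) :
    LinearMap.trace ℂ (EuclideanSpace ℂ ι) (toEuclideanLin M) = M.trace := by
  rw [toEuclideanLin_eq_toLin_orthonormal, Matrix.trace_toLin_eq]

lemma toEuclideanLin_mul_eq_comp (M N : Matrix ι ι ℂ) :
    toEuclideanLin (M * N) = toEuclideanLin M ∘ₗ toEuclideanLin N := by
  rw [toEuclideanLin_eq_toLin_orthonormal, Matrix.toLin_mul _ (EuclideanSpace.basisFun ι ℂ).toBasis]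

lemma adjoint_comp_toEuclideanLin (A : Matrix ι ι ℂ) :
    LinearMap.adjoint (toEuclideanLin A) ∘ₗ toEuclideanLin A = toEuclideanLin (Aᴴ * A) := by
  rw [toEuclideanLin_mul_eq_comp, toEuclideanLin_conjTranspose_eq_adjoint]

lemma sum_singularValues_sq (A : Matrix ι ι ℂ) :
    ∑ k ∈ Finset.range (Fintype.card ι), (toEuclideanLin A).singularValues k ^ 2 =
      ‖matVec A‖ ^ 2 := by
  have hn : Module.finrank ℂ (EuclideanSpace ℂ ι) = Fintype.card ι := finrank_euclideanSpace
  have h := (toEuclideanLin A).isSymmetric_adjoint_comp_self.trace_eq_sum_eigenvalues hn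
  rw [Finset.sum_range, norm_matVec_sq_eq_trace, ← trace_toEuclideanLin,
    ← adjoint_comp_toEuclideanLin, h]
  simp only [(toEuclideanLin A).sq_singularValues_fin hn]
  exact (Complex.ofReal_re _).symm

/-- Both sides are the trace of `(Aᴴ A)²`, computed on the left in an eigenbasis of `Aᴴ A`, whose
eigenvalues are the squared singular values. -/
lemma sum_singularValues_pow_four (A : Matrix ι ι ℂ) :
    ∑ k ∈ Finset.range (Fintype.card ι), (toEuclideanLin A).singularValues k ^ 4 =
      fourNormSq A ^ 2 := by
  have hn : Module.finrank ℂ (EuclideanSpace ℂ ι) = Fintype.card ι := finrank_euclideanSpace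
  have hS := (toEuclideanLin A).isSymmetric_adjoint_comp_self
  have h : LinearMap.trace ℂ (EuclideanSpace ℂ ι) (toEuclideanLin ((Aᴴ * A) * (Aᴴ * A))) =
      ((∑ i, hS.eigenvalues hn i ^ 2 : ℝ) : ℂ) := by
    rw [toEuclideanLin_mul_eq_comp, ← adjoint_comp_toEuclideanLin,
      LinearMap.trace_eq_sum_inner _ (hS.eigenvectorBasis hn), Complex.ofReal_sum]
    refine Finset.sum_congr rfl fun i _ => ?_
    rw [LinearMap.comp_apply (LinearMap.adjoint _ ∘ₗ _), hS.apply_eigenvectorBasis, map_smul,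
      hS.apply_eigenvectorBasis, smul_smul, inner_smul_right,
      inner_self_eq_norm_sq_to_K, (hS.eigenvectorBasis hn).orthonormal.1]
    simp [pow_two]
  rw [trace_toEuclideanLin] at h
  rw [Finset.sum_range, fourNormSq, norm_matVec_sq_eq_trace, conjTranspose_mul,
    conjTranspose_conjTranspose, h, Complex.ofReal_re]
  refine Finset.sum_congr rfl fun i _ => ?_
  rw [← (toEuclideanLin A).sq_singularValues_fin hn i, ← pow_mul]

lemma normalizedNorm_two_rpow (A : Matrix ι ι ℂ) :
    normalizedNorm 2 A ^ (2 : ℝ) = ‖matVec A‖ ^ 2 / Fintype.card ι := by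
  rw [normalizedNorm, ← Real.rpow_mul, one_div_mul_cancel two_ne_zero, Real.rpow_one]
  · simp only [Real.rpow_two]
    rw [sum_singularValues_sq]; ring
  · exact mul_nonneg (by positivity) (Finset.sum_nonneg fun k _ =>
      Real.rpow_nonneg (LinearMap.singularValues_nonneg _ _) _)

lemma normalizedNorm_four_rpow (A : Matrix ι ι ℂ) :
    normalizedNorm 4 A ^ (4 : ℝ) = fourNormSq A ^ 2 / Fintype.card ι := by
  rw [normalizedNorm, ← Real.rpow_mul, one_div_mul_cancel four_ne_zero, Real.rpow_one]
  · have : ∀ x : ℝ, x ^ (4 : ℝ) = x ^ 4 := fun x => by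
      rw [← Real.rpow_natCast]; norm_num
    simp only [this]
    rw [sum_singularValues_pow_four]; ring
  · exact mul_nonneg (by positivity) (Finset.sum_nonneg fun k _ =>
      Real.rpow_nonneg (LinearMap.singularValues_nonneg _ _) _)

end NormalizedNorm

/-! ### The tensor basis -/

variable {m h n : ℕ} {B : Fin (m ^ 2) → Matrix (Fin m) (Fin m) ℂ}

lemma card_index : Fintype.card (Fin h → Fin m) = m ^ h := by simp

lemma matInner_eq_inner {ι : Type*} [Fintype ι] (A C : Matrix ι ι ℂ) :
    matInner A C = (Fintype.card ι : ℂ)⁻¹ * inner ℂ (matVec A) (matVec C) := by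
  rw [matInner, inner_matVec, one_div]

lemma matInner_eq_sum {ι : Type*} [Fintype ι] (A C : Matrix ι ι ℂ) :
    matInner A C = (Fintype.card ι : ℂ)⁻¹ * ∑ i, ∑ j, star (A i j) * C i j := by
  rw [matInner, one_div, Matrix.trace, Finset.sum_comm]
  rfl

lemma matInner_sum_smul {ι κ : Type*} [Fintype ι] (s : Finset κ) (A : Matrix ι ι ℂ) (c : κ → ℂ)
    (C : κ → Matrix ι ι ℂ) :
    matInner A (∑ k ∈ s, c k • C k) = ∑ k ∈ s, c k * matInner A (C k) := by
  simp only [matInner_eq_inner, map_sum, map_smul, inner_sum, inner_smul_right, Finset.mul_sum]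
  exact Finset.sum_congr rfl fun k _ => by ring

lemma matInner_tensorBasis (hB : IsStandardBasis B) (σ σ' : Fin h → Fin (m ^ 2)) :
    matInner (tensorBasis B σ) (tensorBasis B σ') = if σ = σ' then 1 else 0 := by
  have e : matInner (tensorBasis B σ) (tensorBasis B σ') =
      ∏ k, matInner (B (σ k)) (B (σ' k)) := by
    simp only [matInner_eq_sum, Finset.prod_mul_distrib, Finset.prod_univ_sum,
      Fintype.piFinset_univ, tensorBasis, Matrix.of_apply, card_index, Fintype.card_fin]
    congr 1
    · simp
    · refine Finset.sum_congr rfl fun a _ => Finset.sum_congr rfl fun b _ => ?_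
      simp
  rw [e]
  simp only [hB.orthonormal]
  split_ifs with hσ
  · simp [hσ]
  · obtain ⟨k, hk⟩ := Function.ne_iff.1 hσ
    exact Finset.prod_eq_zero (Finset.mem_univ k) (by simp [hk])

/-- The tensor basis, normalized, as an orthonormal family of vectors. -/
def tensorVec (B : Fin (m ^ 2) → Matrix (Fin m) (Fin m) ℂ) (σ : Fin h → Fin (m ^ 2)) :
    EuclideanSpace ℂ ((Fin h → Fin m) × (Fin h → Fin m)) :=
  ((√((m : ℝ) ^ h))⁻¹ : ℂ) • matVec (tensorBasis B σ)

lemma sqrt_inv_mul_self (m h : ℕ) :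
    ((√((m : ℝ) ^ h))⁻¹ : ℂ) * ((√((m : ℝ) ^ h))⁻¹ : ℂ) = ((m : ℂ) ^ h)⁻¹ := by
  rw [← mul_inv, ← Complex.ofReal_mul, Real.mul_self_sqrt (by positivity)]
  push_cast; rfl

lemma orthonormal_tensorVec (hB : IsStandardBasis B) :
    Orthonormal ℂ (tensorVec (h := h) B) := by
  rw [orthonormal_iff_ite]
  intro σ σ'
  rw [← matInner_tensorBasis hB, matInner_eq_inner, card_index, tensorVec, tensorVec,
    inner_smul_left, inner_smul_right, ← mul_assoc]
  congr 1
  rw [map_inv₀, Complex.conj_ofReal, sqrt_inv_mul_self]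
  push_cast; rfl

/-- The tensor basis, normalized, as an orthonormal basis of the space of vectors. -/
def tensorONB (hm : 0 < m) (hB : IsStandardBasis B) :
    OrthonormalBasis (Fin h → Fin (m ^ 2)) ℂ
      (EuclideanSpace ℂ ((Fin h → Fin m) × (Fin h → Fin m))) :=
  haveI : NeZero (m ^ 2) := ⟨by positivity⟩
  OrthonormalBasis.mk (orthonormal_tensorVec hB) (by
    -- Dimension count: `(m²)^h = (m^h)²`, so the orthonormal family spans.
    have hcard : Fintype.card (Fin h → Fin (m ^ 2)) =
        Module.finrank ℂ (EuclideanSpace ℂ ((Fin h → Fin m) × (Fin h → Fin m))) := by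
      simp [← pow_mul, ← pow_add, two_mul]
    rw [← coe_basisOfOrthonormalOfCardEqFinrank (orthonormal_tensorVec hB) hcard,
      Module.Basis.span_eq])

lemma tensorONB_apply (hm : 0 < m) (hB : IsStandardBasis B) (σ : Fin h → Fin (m ^ 2)) :
    tensorONB hm hB σ = tensorVec B σ := by
  simp [tensorONB]

lemma inner_tensorVec (σ : Fin h → Fin (m ^ 2)) (A : TensorMat m h) :
    inner ℂ (tensorVec B σ) (matVec A) = (√((m : ℝ) ^ h) : ℂ) * matInner (tensorBasis B σ) A := by
  have e : ((m : ℂ) ^ h)⁻¹ = ((√((m : ℝ) ^ h))⁻¹ : ℂ) * ((√((m : ℝ) ^ h))⁻¹ : ℂ) :=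
    (sqrt_inv_mul_self m h).symm
  rw [tensorVec, inner_smul_left, matInner_eq_inner, card_index, map_inv₀, Complex.conj_ofReal]
  push_cast
  rw [e, ← mul_assoc, ← mul_assoc]
  congr 1
  by_cases h0 : (√((m : ℝ) ^ h) : ℂ) = 0
  · rw [h0]; simp
  · field_simp

/-- Parseval's identity for the tensor basis. -/
lemma norm_matVec_sq_div (hm : 0 < m) (hB : IsStandardBasis B) (A : TensorMat m h) :
    ‖matVec A‖ ^ 2 / (m : ℝ) ^ h = ∑ σ, ‖matInner (tensorBasis B σ) A‖ ^ 2 := by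
  have hm' : (0 : ℝ) < (m : ℝ) ^ h := by positivity
  rw [div_eq_iff hm'.ne', ← (tensorONB hm hB).sum_sq_norm_inner_right, Finset.sum_mul]
  refine Finset.sum_congr rfl fun σ _ => ?_
  rw [tensorONB_apply, inner_tensorVec, norm_mul, Complex.norm_real, mul_pow, Real.norm_eq_abs,
    sq_abs, Real.sq_sqrt hm'.le, mul_comm]

lemma matVec_injective {ι : Type*} [Fintype ι] : Function.Injective (matVec (ι := ι)) := by
  intro A C hAC
  ext i j
  exact congrArg (fun v : EuclideanSpace ℂ (ι × ι) => v (i, j)) hAC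

/-- Expansion of a matrix in the tensor basis. -/
lemma sum_matInner_smul_tensorBasis (hm : 0 < m) (hB : IsStandardBasis B) (A : TensorMat m h) :
    ∑ σ, matInner (tensorBasis B σ) A • tensorBasis B σ = A := by
  have hm' : (0 : ℝ) < √((m : ℝ) ^ h) := by positivity
  refine matVec_injective ?_
  conv_rhs => rw [← (tensorONB hm hB).sum_repr' (matVec A)]
  rw [map_sum]
  refine Finset.sum_congr rfl fun σ _ => ?_
  rw [tensorONB_apply, inner_tensorVec, tensorVec, map_smul, smul_smul, mul_right_comm,
    mul_inv_cancel₀ (by exact_mod_cast hm'.ne'), one_mul]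

lemma matInner_sum_smul_tensorBasis (hB : IsStandardBasis B) (c : (Fin h → Fin (m ^ 2)) → ℂ)
    (σ : Fin h → Fin (m ^ 2)) :
    matInner (tensorBasis B σ) (∑ σ', c σ' • tensorBasis B σ') = c σ := by
  rw [matInner_sum_smul]
  simp only [matInner_tensorBasis hB, mul_ite, mul_one, mul_zero, Finset.sum_ite_eq,
    Finset.mem_univ, if_true]

/-- Orthogonality to the basis element `1`. -/
lemma trace_eq_zero_of_ne_zero (hm : 0 < m) (hB : IsStandardBasis B) (i : Fin (m ^ 2))
    (hi : i.val ≠ 0) : (B i).trace = 0 := by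
  have h0 : 0 < m ^ 2 := by positivity
  have h := hB.orthonormal ⟨0, h0⟩ i
  rw [if_neg (fun h => hi (by rw [← h])), hB.eq_one ⟨0, h0⟩ rfl, matInner] at h
  have hmc : (m : ℂ) ≠ 0 := by exact_mod_cast hm.ne'
  simpa [hmc] using h

lemma depolarizeAt_tensorBasis (hm : 0 < m) (hB : IsStandardBasis B) (ρ : ℝ) (k : Fin h)
    (σ : Fin h → Fin (m ^ 2)) :
    depolarizeAt ρ k (tensorBasis B σ) =
      (if (σ k).val ≠ 0 then (ρ : ℂ) else 1) • tensorBasis B σ := by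
  have hmc : (m : ℂ) ≠ 0 := by exact_mod_cast hm.ne'
  ext a b
  have e : ∀ s t, tensorBasis B σ (Function.update a k s) (Function.update b k t) =
      B (σ k) s t * ∏ j ∈ Finset.univ.erase k, B (σ j) (a j) (b j) := by
    intro s t
    simp only [tensorBasis, Matrix.of_apply]
    rw [← Finset.mul_prod_erase _ _ (Finset.mem_univ k)]
    simp only [Function.update_self]
    congr 1
    refine Finset.prod_congr rfl fun j hj => ?_
    rw [Function.update_of_ne (Finset.ne_of_mem_erase hj),
      Function.update_of_ne (Finset.ne_of_mem_erase hj)]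
  have e0 := e (a k) (b k)
  rw [Function.update_eq_self, Function.update_eq_self] at e0
  have e1 : ∑ s, tensorBasis B σ (Function.update a k s) (Function.update b k s) =
      (B (σ k)).trace * ∏ j ∈ Finset.univ.erase k, B (σ j) (a j) (b j) := by
    simp only [e, ← Finset.sum_mul]; rfl
  rw [depolarizeAt_apply, e1, Matrix.smul_apply, e0, smul_eq_mul]
  by_cases h1 : (σ k).val = 0
  · rw [hB.eq_one _ h1, Matrix.trace_one, Matrix.one_apply, Fintype.card_fin, if_neg (not_not.2 h1)]
    split_ifs
    · push_cast
      field_simp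
      ring
    · ring
  · rw [trace_eq_zero_of_ne_zero hm hB _ h1, if_pos h1]
    ring

lemma depolarizeAll_tensorBasis (hm : 0 < m) (hB : IsStandardBasis B) (ρ : ℝ)
    (σ : Fin h → Fin (m ^ 2)) :
    depolarizeAll ρ (tensorBasis B σ) = ((ρ : ℂ) ^ suppCard σ) • tensorBasis B σ := by
  have hl : ∀ l : List (Fin h), l.foldr (fun k Q => depolarizeAt ρ k Q) (tensorBasis B σ) =
      (l.map fun k => if (σ k).val ≠ 0 then (ρ : ℂ) else 1).prod • tensorBasis B σ := by
    intro l
    induction l with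
    | nil => simp
    | cons k l ih =>
      rw [List.foldr_cons, ih]
      change depolarizeAtLin ρ k _ = _
      rw [map_smul]
      change _ • depolarizeAt ρ k _ = _
      rw [depolarizeAt_tensorBasis hm hB, smul_smul, List.map_cons, List.prod_cons, mul_comm]
  rw [depolarizeAll, hl]
  congr 1
  rw [← List.ofFn_eq_map, List.prod_ofFn, suppCard, Finset.prod_ite]
  simp

end TensorBasis

section HybridNoise

open Matrix

/-! ### Hypercontractivity of the hybrid noise -/

variable {m h n : ℕ} {B : Fin (m ^ 2) → Matrix (Fin m) (Fin m) ℂ}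

lemma hybridNoise_eq_depolarizeAll (ρ : ℝ) (P : (Fin n → ℝ) → TensorMat m h) (x : Fin n → ℝ) :
    hybridNoise B ρ P x =
      depolarizeAll ρ (∑ σ, ornsteinUhlenbeck ρ (coeffFun B P σ) x • tensorBasis B σ) := by
  simp only [hybridNoise, ← depolarizeAllLin_apply, map_sum, map_smul]

lemma opNorm_two_eq (hm : 0 < m) (hB : IsStandardBasis B) {P : (Fin n → ℝ) → TensorMat m h}
    (hP : MemLpOp B 2 P) :
    opNorm 2 P = (∑ σ, ∫ x, ‖coeffFun B P σ x‖ ^ 2 ∂(gamma n)) ^ (1 / 2 : ℝ) := by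
  rw [opNorm]
  congr 1
  rw [← integral_finsetSum _ fun σ _ => (hP σ).integrable_norm_pow two_ne_zero]
  refine integral_congr_ae (Filter.Eventually.of_forall fun x => ?_)
  simp only [normalizedNorm_two_rpow, card_index, Nat.cast_pow]
  exact norm_matVec_sq_div hm hB (P x)

/-- For fixed `x` the Gaussian noise enters only through its values, so the matrix inequality
applies and Parseval rewrites its right side. -/
lemma normalizedNorm_four_hybridNoise_le (hm : 0 < m) (hB : IsStandardBasis B) {ρ : ℝ}
    (h1 : 4 * ρ ^ 2 ≤ 1) (h2 : 3 * ρ ^ 4 * m ≤ 1) (P : (Fin n → ℝ) → TensorMat m h)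
    (x : Fin n → ℝ) :
    normalizedNorm 4 (hybridNoise B ρ P x) ^ (4 : ℝ) ≤
      (∑ σ, ‖ornsteinUhlenbeck ρ (coeffFun B P σ) x‖ ^ 2) ^ 2 := by
  have hN : (0 : ℝ) < (m : ℝ) ^ h := by positivity
  rw [normalizedNorm_four_rpow, card_index, Nat.cast_pow, hybridNoise_eq_depolarizeAll]
  set M := ∑ σ, ornsteinUhlenbeck ρ (coeffFun B P σ) x • tensorBasis B σ with hM
  have e : ∑ σ, ‖ornsteinUhlenbeck ρ (coeffFun B P σ) x‖ ^ 2 = ‖matVec M‖ ^ 2 / (m : ℝ) ^ h := by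
    rw [norm_matVec_sq_div hm hB, hM]
    simp only [matInner_sum_smul_tensorBasis hB]
  rw [e, div_pow, div_le_div_iff₀ hN (by positivity)]
  have h3 := card_mul_fourNormSq_depolarizeAll_sq_le hm h1 h2 M
  calc fourNormSq (depolarizeAll ρ M) ^ 2 * ((m : ℝ) ^ h) ^ 2
      = ((m : ℝ) ^ h * fourNormSq (depolarizeAll ρ M) ^ 2) * (m : ℝ) ^ h := by ring
    _ ≤ _ := mul_le_mul_of_nonneg_right h3 hN.le

lemma noise_bounds {ρ : ℝ} (hm : 1 < m) (hρ0 : 0 ≤ ρ) (hρ : ρ ≤ 1 / √(3 * √(m : ℝ))) :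
    4 * ρ ^ 2 ≤ 1 ∧ 3 * ρ ^ 4 * m ≤ 1 ∧ 3 * ρ ^ 2 ≤ 1 := by
  have hm2 : (2 : ℝ) ≤ m := by exact_mod_cast hm
  have hs2 : √(m : ℝ) ^ 2 = m := Real.sq_sqrt (by positivity)
  -- `16/9 ≤ 2 ≤ m`; this turns `3√m ρ² ≤ 1` into the dimension-free condition `4ρ² ≤ 1`.
  have hs : 4 / 3 ≤ √(m : ℝ) := Real.le_sqrt_of_sq_le (by norm_num; linarith)
  have h1 : ρ ^ 2 * (3 * √(m : ℝ)) ≤ 1 := by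
    have h := pow_le_pow_left₀ hρ0 hρ 2
    rw [div_pow, one_pow, Real.sq_sqrt (by positivity), le_div_iff₀ (by positivity)] at h
    exact h
  have h2 : (ρ ^ 2 * (3 * √(m : ℝ))) ^ 2 ≤ 1 := pow_le_one₀ (by positivity) h1
  have h3 : 4 * ρ ^ 2 ≤ 1 := by nlinarith [sq_nonneg ρ]
  refine ⟨h3, ?_, by nlinarith [sq_nonneg ρ]⟩
  have e : (ρ ^ 2 * (3 * √(m : ℝ))) ^ 2 = 9 * (ρ ^ 4 * m) := by
    rw [mul_pow, mul_pow, hs2]; ring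
  rw [e] at h2
  have : 0 ≤ ρ ^ 4 * m := by positivity
  linarith

/-- Hypercontractivity of the hybrid noise operator, from `L²` to `L⁴`. -/
theorem hybridNoise_hypercontractive (hm : 1 < m) (hB : IsStandardBasis B)
    {P : (Fin n → ℝ) → TensorMat m h} (hP : MemLpOp B 2 P) {ρ : ℝ} (hρ0 : 0 ≤ ρ)
    (hρ : ρ ≤ 1 / √(3 * √(m : ℝ))) :
    MemLpOp B 4 (hybridNoise B ρ P) ∧ opNorm 4 (hybridNoise B ρ P) ≤ opNorm 2 P := by
  obtain ⟨h1, h2, h3⟩ := noise_bounds hm hρ0 hρ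
  have hm0 : 0 < m := by omega
  have hU := fun σ => ornsteinUhlenbeck_hypercontractive h3 (hP σ)
  refine ⟨fun σ => ?_, ?_⟩
  · have e : coeffFun B (hybridNoise B ρ P) σ = fun x => ∑ σ',
        ornsteinUhlenbeck ρ (coeffFun B P σ') x *
          matInner (tensorBasis B σ) (depolarizeAll ρ (tensorBasis B σ')) := by
      ext x
      rw [coeffFun, hybridNoise, matInner_sum_smul]
    rw [e]
    exact memLp_finsetSum _ fun σ' _ => (hU σ').1.mul_const _
  · set a : (Fin h → Fin (m ^ 2)) → ℝ := fun σ => ∫ x, ‖coeffFun B P σ x‖ ^ 2 ∂(gamma n)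
    have ha : ∀ σ, 0 ≤ a σ := fun σ => integral_nonneg fun x => by positivity
    have hfour : ∫ x, normalizedNorm 4 (hybridNoise B ρ P x) ^ (4 : ℝ) ∂(gamma n) ≤
        (∑ σ, a σ) ^ 2 := by
      have hmem : ∀ σ, MemLp (fun x => ‖ornsteinUhlenbeck ρ (coeffFun B P σ) x‖) 4 (gamma n) :=
        fun σ => (hU σ).1.norm
      calc ∫ x, normalizedNorm 4 (hybridNoise B ρ P x) ^ (4 : ℝ) ∂(gamma n)
          ≤ ∫ x, (∑ σ, 1 * ‖ornsteinUhlenbeck ρ (coeffFun B P σ) x‖ ^ 2) ^ 2 ∂(gamma n) := by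
            refine integral_mono_of_nonneg (Filter.Eventually.of_forall fun x => ?_) ?_
              (Filter.Eventually.of_forall fun x => ?_)
            · simp only [Pi.zero_apply, normalizedNorm_four_rpow]
              positivity
            · exact MemLp.integrable_sq
                (memLp_finsetSum _ fun σ _ => (memLp_sq (hmem σ)).const_mul _)
            · simp only [one_mul]
              exact normalizedNorm_four_hybridNoise_le hm0 hB h1 h2 P x
        _ ≤ (∑ σ, 1 * √(∫ x, ‖ornsteinUhlenbeck ρ (coeffFun B P σ) x‖ ^ 4 ∂(gamma n))) ^ 2 :=
            integral_sum_sq_sq_le _ _ (fun _ _ => zero_le_one) _ fun σ _ => hmem σ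
        _ ≤ (∑ σ, a σ) ^ 2 := by
            refine pow_le_pow_left₀ (Finset.sum_nonneg fun _ _ => by positivity) ?_ 2
            refine Finset.sum_le_sum fun σ _ => ?_
            rw [one_mul]
            exact Real.sqrt_le_iff.2 ⟨ha σ, (hU σ).2⟩
    rw [opNorm_two_eq hm0 hB hP, opNorm]
    have hA : 0 ≤ ∑ σ, a σ := Finset.sum_nonneg fun σ _ => ha σ
    calc (∫ x, normalizedNorm 4 (hybridNoise B ρ P x) ^ (4 : ℝ) ∂(gamma n)) ^ (1 / 4 : ℝ)
        ≤ ((∑ σ, a σ) ^ 2) ^ (1 / 4 : ℝ) := by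
          refine Real.rpow_le_rpow (integral_nonneg fun x => ?_) hfour (by norm_num)
          simp only [Pi.zero_apply, normalizedNorm_four_rpow]
          positivity
      _ = (∑ σ, a σ) ^ (1 / 2 : ℝ) := by
          rw [← Real.rpow_natCast, ← Real.rpow_mul hA]; norm_num

/-! ### Multilinear random operators -/

/-- The multi-indices in `{0,1}^n`. -/
def multilinearIndices (n : ℕ) : Finset (Fin n → ℕ) := Fintype.piFinset fun _ => Finset.range 2

lemma mem_multilinearIndices (τ : Fin n → ℕ) : τ ∈ multilinearIndices n ↔ ∀ i, τ i ≤ 1 := by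
  simp only [multilinearIndices, Fintype.mem_piFinset, Finset.mem_range]
  exact forall_congr' fun i => by omega

lemma hermiteCoeff_eq_zero_of_notMem {f : (Fin n → ℝ) → ℂ} (hf : IsMultilinearFun f)
    (τ : Fin n → ℕ) (hτ : τ ∉ multilinearIndices n) : hermiteCoeff f τ = 0 := by
  rw [mem_multilinearIndices] at hτ
  push Not at hτ
  exact hf τ hτ

lemma sum_le_hermiteDegree {f : (Fin n → ℝ) → ℂ} (hf : IsMultilinearFun f) (τ : Fin n → ℕ)
    (hτ : hermiteCoeff f τ ≠ 0) : ∑ i, τ i ≤ hermiteDegree f := by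
  -- `sSup` of an unbounded set of naturals is `0`, so a bound is needed; multilinearity provides
  -- `n`.
  refine le_csSup ⟨n, ?_⟩ ⟨τ, hτ, rfl⟩
  rintro k ⟨τ', hτ', rfl⟩
  have h : τ' ∈ multilinearIndices n := by
    by_contra hn
    exact hτ' (hermiteCoeff_eq_zero_of_notMem hf τ' hn)
  rw [mem_multilinearIndices] at h
  simpa using Finset.sum_le_sum fun i (_ : i ∈ Finset.univ) => h i

lemma add_le_totalDegree {P : (Fin n → ℝ) → TensorMat m h} (hP : IsMultilinearOp B P)
    (σ : Fin h → Fin (m ^ 2)) (τ : Fin n → ℕ) (hτ : hermiteCoeff (coeffFun B P σ) τ ≠ 0) :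
    ∑ i, τ i + suppCard σ ≤ totalDegree B P := by
  classical
  refine (Nat.add_le_add_right (sum_le_hermiteDegree (hP σ) τ hτ) _).trans ?_
  rw [totalDegree]
  exact Finset.le_sup (f := fun σ => hermiteDegree (coeffFun B P σ) + suppCard σ)
    (Finset.mem_filter.2 ⟨Finset.mem_univ σ, τ, hτ⟩)

lemma MemLpOp.congr_ae {p : ENNReal} {P Q : (Fin n → ℝ) → TensorMat m h} (hP : MemLpOp B p P)
    (hPQ : P =ᵐ[gamma n] Q) : MemLpOp B p Q := fun σ => (hP σ).ae_eq <| by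
  filter_upwards [hPQ] with x hx
  rw [coeffFun, coeffFun, hx]

lemma opNorm_congr_ae (p : ℝ) {P Q : (Fin n → ℝ) → TensorMat m h} (hPQ : P =ᵐ[gamma n] Q) :
    opNorm p P = opNorm p Q := by
  have h : (fun x => normalizedNorm p (P x) ^ p) =ᵐ[gamma n]
      fun x => normalizedNorm p (Q x) ^ p := by
    filter_upwards [hPQ] with x hx
    rw [hx]
  rw [opNorm, opNorm, integral_congr_ae h]

/-- The moment inequality for multilinear random operators in terms of `ρ⁻¹ = √(3 √m)`. -/
lemma opNorm_four_le_pow (hm : 1 < m) (hB : IsStandardBasis B)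
    {P : (Fin n → ℝ) → TensorMat m h} (hP : MemLpOp B 2 P) (hPm : IsMultilinearOp B P) :
    MemLpOp B 4 P ∧
      opNorm 4 P ≤ √(3 * √(m : ℝ)) ^ totalDegree B P * opNorm 2 P := by
  have hm0 : 0 < m := by omega
  have hm1 : (1 : ℝ) ≤ m := by exact_mod_cast hm0
  set r := √(3 * √(m : ℝ)) with hr
  have hr1 : 1 ≤ r := by
    have : 1 ≤ √(m : ℝ) := Real.one_le_sqrt.2 hm1
    exact Real.one_le_sqrt.2 (by linarith)
  have hr0 : 0 < r := by linarith
  set d := totalDegree B P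
  set c := fun σ τ => hermiteCoeff (coeffFun B P σ) τ
  -- The factor `r ^ (|τ| + |σ|)` inverts the eigenvalue of the hybrid noise at `ρ = 1 / r`, so that
  -- `hybridNoise B (1 / r) Q` recovers `P` almost everywhere.
  set q : (Fin h → Fin (m ^ 2)) → (Fin n → ℝ) → ℂ := fun σ x =>
    ∑ τ ∈ multilinearIndices n, ((r : ℂ) ^ (∑ i, τ i + suppCard σ) * c σ τ) * (hermiteFun τ x : ℂ)
  set Q : (Fin n → ℝ) → TensorMat m h := fun x => ∑ σ, q σ x • tensorBasis B σ
  have hcoeff : ∀ σ, coeffFun B Q σ = q σ := fun σ => by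
    ext x
    exact matInner_sum_smul_tensorBasis hB (fun σ => q σ x) σ
  have hQ : MemLpOp B 2 Q := fun σ => by
    rw [hcoeff]
    exact memLp_sum_ofReal_hermiteFun _ _ _ (by simp)
  have hρ1 : (1 / r) ^ 2 ≤ 1 := by
    rw [div_pow, one_pow, div_le_one (by positivity)]
    exact one_le_pow₀ hr1
  obtain ⟨hmem, hle⟩ := hybridNoise_hypercontractive hm hB hQ (ρ := 1 / r) (by positivity) le_rfl
  have hexp : ∀ σ, coeffFun B P σ =ᵐ[gamma n]
      fun x => ∑ τ ∈ multilinearIndices n, c σ τ * (hermiteFun τ x : ℂ) := fun σ =>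
    ae_eq_sum_hermiteFun (hP σ) _ (hermiteCoeff_eq_zero_of_notMem (hPm σ))
  have hPQ : P =ᵐ[gamma n] hybridNoise B (1 / r) Q := by
    filter_upwards [ae_all_iff.2 hexp] with x hx
    conv_lhs => rw [← sum_matInner_smul_tensorBasis hm0 hB (P x)]
    rw [hybridNoise]
    refine Finset.sum_congr rfl fun σ _ => ?_
    rw [hcoeff, ornsteinUhlenbeck_sum_hermiteFun hρ1, depolarizeAll_tensorBasis hm0 hB, smul_smul]
    congr 1
    refine (hx σ).trans ?_
    rw [Finset.sum_mul]
    refine Finset.sum_congr rfl fun τ _ => ?_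
    have hrc : (r : ℂ) ≠ 0 := by exact_mod_cast hr0.ne'
    push_cast
    rw [pow_add, div_pow, div_pow, one_pow, one_pow]
    field_simp
  refine ⟨hmem.congr_ae hPQ.symm, ?_⟩
  rw [opNorm_congr_ae 4 hPQ]
  refine hle.trans ?_
  rw [opNorm_two_eq hm0 hB hQ, opNorm_two_eq hm0 hB hP]
  have eP : ∀ σ, ∫ x, ‖coeffFun B P σ x‖ ^ 2 ∂(gamma n) =
      ∑ τ ∈ multilinearIndices n, ‖c σ τ‖ ^ 2 := fun σ => by
    rw [← integral_norm_sum_hermiteFun_sq]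
    refine integral_congr_ae ?_
    filter_upwards [hexp σ] with x hx
    rw [hx]
  have eQ : ∀ σ, ∫ x, ‖coeffFun B Q σ x‖ ^ 2 ∂(gamma n) =
      ∑ τ ∈ multilinearIndices n, ‖(r : ℂ) ^ (∑ i, τ i + suppCard σ) * c σ τ‖ ^ 2 := fun σ => by
    rw [← integral_norm_sum_hermiteFun_sq, hcoeff]
  simp only [eP, eQ]
  -- Each nonzero coefficient has `|τ| + |σ| ≤ d`, and `r ≥ 1`, so the inversion enlarges it by at
  -- most `r ^ d`.
  have hsum : ∑ σ, ∑ τ ∈ multilinearIndices n, ‖(r : ℂ) ^ (∑ i, τ i + suppCard σ) * c σ τ‖ ^ 2 ≤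
      (r ^ d) ^ 2 * ∑ σ, ∑ τ ∈ multilinearIndices n, ‖c σ τ‖ ^ 2 := by
    rw [Finset.mul_sum]
    refine Finset.sum_le_sum fun σ _ => ?_
    rw [Finset.mul_sum]
    refine Finset.sum_le_sum fun τ _ => ?_
    by_cases h0 : c σ τ = 0
    · simp [h0]
    · rw [norm_mul, mul_pow, norm_pow, Complex.norm_real, Real.norm_of_nonneg hr0.le]
      gcongr
      exact add_le_totalDegree hPm σ τ h0
  calc _ ≤ ((r ^ d) ^ 2 * ∑ σ, ∑ τ ∈ multilinearIndices n, ‖c σ τ‖ ^ 2) ^ (1 / 2 : ℝ) :=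
        Real.rpow_le_rpow (Finset.sum_nonneg fun _ _ => Finset.sum_nonneg fun _ _ => by positivity)
          hsum (by norm_num)
    _ = _ := by
        rw [Real.mul_rpow (by positivity) (Finset.sum_nonneg fun _ _ => Finset.sum_nonneg
          fun _ _ => by positivity), ← Real.sqrt_eq_rpow, Real.sqrt_sq (by positivity)]

lemma sqrt_three_mul_sqrt_pow (m d : ℕ) :
    √(3 * √(m : ℝ)) ^ d = (3 : ℝ) ^ ((d : ℝ) / 2) * (m : ℝ) ^ ((d : ℝ) / 4) := by
  rw [Real.sqrt_eq_rpow, Real.sqrt_eq_rpow, ← Real.rpow_natCast, ← Real.rpow_mul (by positivity),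
    Real.mul_rpow (by norm_num) (by positivity), ← Real.rpow_mul (by positivity)]
  congr 2 <;> ring

end HybridNoise

end RandomOperator

end

theorem lemma8p10 (m h n : ℕ) (hm : 1 < m)
    (B : Fin (m ^ 2) → Matrix (Fin m) (Fin m) ℂ) (hB : RandomOperator.IsStandardBasis B)
    (P : (Fin n → ℝ) → RandomOperator.TensorMat m h) (hP : RandomOperator.MemLpOp B 2 P) :
    (∀ ρ : ℝ, 0 ≤ ρ → ρ ≤ 1 / √(3 * √(m : ℝ)) →
      RandomOperator.MemLpOp B 4 (RandomOperator.hybridNoise B ρ P) ∧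
      RandomOperator.opNorm 4 (RandomOperator.hybridNoise B ρ P) ≤
        RandomOperator.opNorm 2 P) ∧
    (RandomOperator.IsMultilinearOp B P →
      RandomOperator.MemLpOp B 4 P ∧
      RandomOperator.opNorm 4 P ≤
        (3 : ℝ) ^ ((RandomOperator.totalDegree B P : ℝ) / 2) *
          (m : ℝ) ^ ((RandomOperator.totalDegree B P : ℝ) / 4) *
          RandomOperator.opNorm 2 P) := by
  refine ⟨fun ρ h0 h1 => RandomOperator.hybridNoise_hypercontractive hm hB hP h0 h1, fun hPm => ?_⟩
  rw [← RandomOperator.sqrt_three_mul_sqrt_pow]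
  exact RandomOperator.opNorm_four_le_pow hm hB hP hPm
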